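/- **Theorem (Upper bound for convex and smooth losses).** *Setting.* There are $K\ge 1$ nodes, a feature space $\mathcal X$, a finite label set $\mathcal Y$, a model $h_w$ with parameters $w\in\mathbb R^d$, and a nonnegative loss $\ell$. Node $k$ has labelled training data distributed by a probability measure $p_k^{\rm tr}$ on $\mathcal X\times\mathcal Y$ (the sampling distribution, or the empirical distribution of its training set), whose label marginal satisfies $p_k^{\rm tr}(y)>0$ for all $y$, and unlabelled test points $x_{k,1},\dots,x_{k,n_k}$. All risks $\mathbb E_{p_k^{\rm tr}}[\ell(h_w(x),y)]$ are finite. *Ratios (VRLS).* Given a softmax predictor $f_{\theta_k}:\mathcal X\to\mathbb R^{\mathcal Y}$, where $\theta_k$ is any parameter returned by training, node $k$ computes $$\hat\rho_k\in\arg\max\Big\{\tfrac1{n_k}\sum_{j}\log\big(f_{\theta_k}(x_{k,j})^\top\rho\big)\;:\;\rho\ge 0,\ \sum_y\rho(y)\,p_k^{\rm tr}(y)=1\Big\}.$$ The aggregated ratios are $r_{k,f}(y)=\sum_{j=1}^K\hat\rho_j(y)\,p_j^{\rm tr}(y)/p_k^{\rm tr}(y)$, and $r_{\max}$ is the supremum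 of $r_{k,f}(y)$ over all nodes $k$, labels $y$ and predictors $f=(f_{\theta_1},\dots,f_{\theta_K})$ (and all maximizers $\hat\rho_k$). The importance weighted objective is $$F(w)=\frac1K\sum_{k=1}^K\mathbb E_{(x,y)\sim p_k^{\rm tr}}\big[r_{k,f}(y)\,\ell(h_w(x),y)\big].$$ *Assumptions.* (1) $F$ has a minimizer $w^\star$. (2) For all $(x,y)$ the function $w\mapsto\ell(h_w(x),y)$ is convex and differentiable with $\beta$-Lipschitz gradient, $\beta>0$. (3) Each node has a stochastic gradient $g_k(w,\xi)$ with $\mathbb E[g_k(w,\xi)]=\nabla F(w)$ and $\mathbb E\|g_k(w,\xi)-\nabla F(w)\|^2\le\sigma^2$ for every $w\in\mathbb R^d$. *Algorithm.* All nodes start at $w_0\neq w^\star$. With a constant step size $\eta$, each node performs steps $w\leftarrow w-\eta\,g_k(w,\xi)$ with samples $\xi$ that are independent over nodes and steps; after every $\tau\ge1$ steps, each node's iterate is replaced by the average of all $K$ iterates. After $R\ge1$ such rounds, i.e. $T=\tau R$ stochastic gradients per node, let $w_T$ be the common iterate. *Conclusion.* Put $D=\|w_0-w^\star\|$. There is a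 constant $C$ depending only on $\sigma$ and a step size $\eta>0$ depending only on $\sigma,\beta,r_{\max},D,K,\tau,R$ such that $F(w_T)-F(w^\star)$ is integrable and $$\mathbb E\big[F(w_T)-F(w^\star)\big]\le C\,\big(1+\log(\tau R)\big)\left(\frac{r_{\max}\beta D^2}{\tau R}+\frac{(r_{\max}\beta D^4)^{1/3}}{(\sqrt\tau R)^{2/3}}+\frac{D}{\sqrt{K\tau R}}\right).$$ -/

import Mathlib

open MeasureTheory ProbabilityTheory

noncomputable section

/-- The data of a multi-node learning problem with `K` nodes: feature space `X`, finite label set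
`Y`, space `V` of model outputs, model parameters `w ∈ ℝ^d`, and parameter set `Θ` for the
auxiliary predictors used in the density ratio estimation. -/
structure MultiNode (d K : ℕ) (X Y V Θ : Type*) [MeasurableSpace X] [MeasurableSpace Y] where
  /-- the distribution of the labelled training data of each node
  (the sampling distribution, or the empirical distribution of a training set) -/
  train : Fin K → Measure (X × Y)
  /-- the number of unlabelled test points of each node -/
  numTest : Fin K → ℕ
  /-- the unlabelled test points of each node -/
  test : (k : Fin K) → Fin (numTest k) → X
  /-- the logits of the predictor network with parameter `θ` -/
  logit : Θ → X → Y → ℝ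
  /-- the global model `h_w` -/
  model : EuclideanSpace ℝ (Fin d) → X → V
  /-- the loss `ℓ` -/
  loss : V → Y → ℝ

namespace MultiNode

variable {d K : ℕ} {X Y V Θ : Type*} [MeasurableSpace X] [MeasurableSpace Y] [Fintype Y]

/-- The training label marginal `p_k^tr(y)`. -/
def labelMarginal (S : MultiNode d K X Y V Θ) (k : Fin K) (y : Y) : ℝ :=
  (S.train k).real (Prod.snd ⁻¹' {y})

/-- The predictor `f_θ(x) ∈ ℝ^m`: the softmax of the logits. -/
def predictor (S : MultiNode d K X Y V Θ) (θ : Θ) (x : X) (y : Y) : ℝ :=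
  Real.exp (S.logit θ x y) / ∑ y', Real.exp (S.logit θ x y')

/-- The admissible ratio vectors of node `k`: nonnegative `r` with `∑_y r(y) p_k^tr(y) = 1`. -/
def ratioSet (S : MultiNode d K X Y V Θ) (k : Fin K) : Set (Y → ℝ) :=
  {r | (∀ y, 0 ≤ r y) ∧ ∑ y, r y * S.labelMarginal k y = 1}

/-- The log-likelihood `(1/n) ∑_j log (f_θ(x_j)ᵀ r)` of `r` on the test points of node `k`. -/
def logLikelihood (S : MultiNode d K X Y V Θ) (k : Fin K) (θ : Θ) (r : Y → ℝ) : ℝ :=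
  (S.numTest k : ℝ)⁻¹ *
    ∑ j, Real.log (∑ y, S.predictor θ (S.test k j) y * r y)

/-- Phase 1: `r` is a density ratio `p_k^te / p_k^tr` estimated by node `k` with predictor `f_θ`,
i.e. a maximizer of the log-likelihood over the admissible ratio vectors. -/
def IsRatioEstimate (S : MultiNode d K X Y V Θ) (k : Fin K) (θ : Θ) (r : Y → ℝ) : Prop :=
  r ∈ S.ratioSet k ∧ IsMaxOn (S.logLikelihood k θ) (S.ratioSet k) r

/-- Phase 2: the aggregated ratios `r_k(y) = (∑_j p_j^te(y)) / p_k^tr(y)`, where `p_j^te(y)` is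
replaced by its estimate `ρ_j(y) p_j^tr(y)`. -/
def aggregate (S : MultiNode d K X Y V Θ) (ρ : Fin K → Y → ℝ) (k : Fin K) (y : Y) : ℝ :=
  (∑ j, ρ j y * S.labelMarginal j y) / S.labelMarginal k y

/-- All values `r_{k,f}(y)` that the aggregated ratios can take, over all nodes `k`, labels `y`
and predictors `f = (f_{θ_1}, …, f_{θ_K})`. Their supremum is `r_max`. -/
def ratioValues (S : MultiNode d K X Y V Θ) : Set ℝ :=
  {v | ∃ (θ : Fin K → Θ) (ρ : Fin K → Y → ℝ), (∀ j, S.IsRatioEstimate j (θ j) (ρ j)) ∧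
    ∃ k y, v = S.aggregate ρ k y}

/-- The importance weighted risk of node `k` with weights `r_k = aggregate ρ k`,
`F_k(w) = E_{(x,y) ∼ p_k^tr} [r_k(y) ℓ(h_w(x), y)]`. -/
def nodeRisk (S : MultiNode d K X Y V Θ) (ρ : Fin K → Y → ℝ) (k : Fin K)
    (w : EuclideanSpace ℝ (Fin d)) : ℝ :=
  ∫ z, S.aggregate ρ k z.2 * S.loss (S.model w z.1) z.2 ∂(S.train k)

/-- The global importance weighted objective `F = (1/K) ∑_k F_k`. -/
def risk (S : MultiNode d K X Y V Θ) (ρ : Fin K → Y → ℝ)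
    (w : EuclideanSpace ℝ (Fin d)) : ℝ :=
  (K : ℝ)⁻¹ * ∑ k, S.nodeRisk ρ k w

/-- Standing properties of the data: the training data of each node are distributed by a
probability measure that charges every label, losses are nonnegative, and risks are finite. -/
structure Regular (S : MultiNode d K X Y V Θ) : Prop where
  isProb : ∀ k, IsProbabilityMeasure (S.train k)
  marginal_pos : ∀ k y, 0 < S.labelMarginal k y
  loss_nonneg : ∀ v y, 0 ≤ S.loss v y
  integrable_loss : ∀ k w, Integrable (fun z => S.loss (S.model w z.1) z.2) (S.train k)

end MultiNode

/-- `φ` is convex, differentiable, and its gradient is `β`-Lipschitz. -/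
structure ConvexSmooth {d : ℕ} (β : ℝ) (φ : EuclideanSpace ℝ (Fin d) → ℝ) : Prop where
  convex : ConvexOn ℝ Set.univ φ
  differentiable : Differentiable ℝ φ
  smooth : ∀ v w, ‖gradient φ v - gradient φ w‖ ≤ β * ‖v - w‖

/-- Stochastic gradient `g(w) = g(w, ξ)`, `ξ ∼ ν`, which for every `w` is an unbiased estimate
of `∇F(w)` with variance at most `σ²`. -/
structure StochasticGradient {d : ℕ} {Ξ : Type*} [MeasurableSpace Ξ] (ν : Measure Ξ) (σ : ℝ)
    (F : EuclideanSpace ℝ (Fin d) → ℝ)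
    (g : EuclideanSpace ℝ (Fin d) → Ξ → EuclideanSpace ℝ (Fin d)) : Prop where
  measurable : Measurable (Function.uncurry g)
  integrable : ∀ w, Integrable (g w) ν
  unbiased : ∀ w, ∫ ξ, g w ξ ∂ν = gradient F w
  integrable_sq : ∀ w, Integrable (fun ξ => ‖g w ξ - gradient F w‖ ^ 2) ν
  variance_le : ∀ w, ∫ ξ, ‖g w ξ - gradient F w‖ ^ 2 ∂ν ≤ σ ^ 2

/-- Phase 3: training with local updates and constant step size `η`. `localSGD τ η g w₀ ξ t k` is
the iterate of node `k` after `t` stochastic gradients per node; `ξ k t` is the sample that node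
`k` uses in step `t`. After every `τ` local steps the nodes communicate and each of them
continues from the average of all iterates. -/
def localSGD {d K : ℕ} {Ξ : Type*} (τ : ℕ) (η : ℝ)
    (g : Fin K → EuclideanSpace ℝ (Fin d) → Ξ → EuclideanSpace ℝ (Fin d))
    (w₀ : EuclideanSpace ℝ (Fin d)) (ξ : Fin K → ℕ → Ξ) :
    ℕ → Fin K → EuclideanSpace ℝ (Fin d)
  | 0 => fun _ => w₀
  | t + 1 =>
    let step : Fin K → EuclideanSpace ℝ (Fin d) := fun k =>
      localSGD τ η g w₀ ξ t k - η • g k (localSGD τ η g w₀ ξ t k) (ξ k t)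
    if τ ∣ t + 1 then fun _ => (K : ℝ)⁻¹ • ∑ k, step k else step

/-- The global model `w_t` after `t` steps: the average of the nodes' iterates (at the end of a
communication round all nodes hold this same vector). -/
def globalIterate {d K : ℕ} {Ξ : Type*} (τ : ℕ) (η : ℝ)
    (g : Fin K → EuclideanSpace ℝ (Fin d) → Ξ → EuclideanSpace ℝ (Fin d))
    (w₀ : EuclideanSpace ℝ (Fin d)) (ξ : Fin K → ℕ → Ξ) (t : ℕ) :
    EuclideanSpace ℝ (Fin d) :=
  (K : ℝ)⁻¹ • ∑ k, localSGD τ η g w₀ ξ t k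

end

/-! The aggregated ratios are nonnegative weights bounded by `rmax`, so `F` is an average of
weighted integrals of convex smooth losses, hence convex and smooth with constant `M = 2 * β *
rmax`. Since every node has unbiased gradients of this same `F`, what remains is a last iterate
bound for local SGD on one convex smooth objective.

The mean of the iterates makes a gradient step whose gradients are taken at the scattered points of
the nodes; synchronisation does not change the mean. Against any comparison point `z` orthogonal to
the new noise, `LocalDescent.integral_step_le` bounds the expected gap by a telescoping difference
of squared distances plus `e = η σ² / K + M τ η² σ²`. The first part of `e` is the variance of the
mean of `K` orthogonal noises. The second is the spread of the nodes: gradient steps do not expand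
distances, so only the noise of at most `τ` local steps drives nodes apart.

Taking `z = wstar` bounds the average gap over all steps. Taking for `z` the mean iterate at time `T
- m` makes the initial distance zero, so the average over the last `m` steps exceeds the value at
time `T - m` by at most `e`. Chaining these suffix averages down to the last step costs `e` times a
harmonic sum, which is the source of the logarithm. Finally `balancedStep` balances `D² / (η T)`
against the two parts of `e`. -/

/-! ### Convex functions with quadratic upper bounds -/

/-- `F` lies above its affine approximations with slopes `p`, and exceeds them at most
quadratically. For convex differentiable `F` this says that `p` is the gradient of `F` and
that `F` is `M`-smooth. -/
structure QuadraticBounds {E : Type*} [NormedAddCommGroup E] [InnerProductSpace ℝ E] (M : ℝ)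
    (F : E → ℝ) (p : E → E) : Prop where
  lower : ∀ u v, F u + inner ℝ (p u) (v - u) ≤ F v
  upper : ∀ u v, F v ≤ F u + inner ℝ (p u) (v - u) + M / 2 * ‖v - u‖ ^ 2

theorem ConvexOn.add_inner_gradient_le {E : Type*} [NormedAddCommGroup E]
    [InnerProductSpace ℝ E] [CompleteSpace E] {φ : E → ℝ} (hφ : ConvexOn ℝ Set.univ φ) {u : E}
    (hd : DifferentiableAt ℝ φ u) (v : E) :
    φ u + inner ℝ (gradient φ u) (v - u) ≤ φ v := by
  have hc : ConvexOn ℝ Set.univ (fun t : ℝ => φ (AffineMap.lineMap u v t)) := by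
    simpa [Function.comp_def] using hφ.comp_affineMap (AffineMap.lineMap (k := ℝ) u v)
  have hder : HasDerivAt (fun t : ℝ => φ (AffineMap.lineMap u v t))
      (inner ℝ (gradient φ u) (v - u)) 0 := by
    have h1 : HasFDerivAt φ (fderiv ℝ φ u) (AffineMap.lineMap u v (0 : ℝ)) := by
      simpa using hd.hasFDerivAt
    have h2 := h1.comp_hasDerivAt (0 : ℝ) (AffineMap.hasDerivAt_lineMap (a := u) (b := v))
    rw [inner_gradient_left]
    exact h2
  have := hc.le_slope_of_hasDerivAt (Set.mem_univ 0) (Set.mem_univ 1) zero_lt_one hder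
  rw [slope_def_field] at this
  simp only [AffineMap.lineMap_apply_one, AffineMap.lineMap_apply_zero, sub_zero, div_one] at this
  linarith

/-- The upper bound combines convexity at `v` with the Lipschitz bound between the gradients at `u`
and `v`. This costs a factor 2 against the sharp constant `β` but needs no integration along the
segment. -/
theorem ConvexSmooth.quadraticBounds {d : ℕ} {β : ℝ} {φ : EuclideanSpace ℝ (Fin d) → ℝ}
    (h : ConvexSmooth β φ) : QuadraticBounds (2 * β) φ (gradient φ) where
  lower u v := h.convex.add_inner_gradient_le (h.differentiable u) v
  upper u v := by
    have h1 := h.convex.add_inner_gradient_le (h.differentiable v) u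
    have h2 : inner ℝ (gradient φ v - gradient φ u) (v - u) ≤ β * ‖v - u‖ * ‖v - u‖ :=
      (real_inner_le_norm _ _).trans
        (mul_le_mul_of_nonneg_right (h.smooth v u) (norm_nonneg _))
    rw [inner_sub_left] at h2
    rw [← neg_sub v u, inner_neg_right] at h1
    nlinarith

namespace QuadraticBounds

variable {E : Type*} [NormedAddCommGroup E] [InnerProductSpace ℝ E] {M : ℝ} {F : E → ℝ}
  {p : E → E}

/-- The first order remainder lies between 0 and a multiple of `‖v - u‖ ^ 2`. Consequently the
bounds alone identify the gradient, and a risk never has to be differentiated under the integral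
sign. -/
theorem hasGradientAt [CompleteSpace E] (h : QuadraticBounds M F p) (u : E) :
    HasGradientAt F (p u) u := by
  rw [hasGradientAt_iff_isLittleO]
  have hO : (fun v => F v - F u - inner ℝ (p u) (v - u)) =O[nhds u]
      fun v => ‖v - u‖ ^ 2 := by
    refine Asymptotics.IsBigO.of_bound (M / 2) (Filter.Eventually.of_forall fun v => ?_)
    have h1 := h.lower u v
    have h2 := h.upper u v
    rw [Real.norm_eq_abs, Real.norm_eq_abs, abs_of_nonneg (by linarith),
      abs_of_nonneg (by positivity)]
    linarith
  exact hO.trans_isLittleO (Asymptotics.isLittleO_pow_sub_sub u one_lt_two)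

theorem gradient_eq [CompleteSpace E] (h : QuadraticBounds M F p) : gradient F = p :=
  _root_.gradient_eq h.hasGradientAt

theorem continuous [CompleteSpace E] (h : QuadraticBounds M F p) : Continuous F :=
  continuous_iff_continuousAt.2 fun u => (h.hasGradientAt u).continuousAt

theorem abs_sub_le (h : QuadraticBounds M F p) (u v : E) :
    |F v - F u| ≤ ‖p u‖ * ‖v - u‖ + M / 2 * ‖v - u‖ ^ 2 := by
  have h1 := h.lower u v
  have h2 := h.upper u v
  have h3 := abs_le.1 (abs_real_inner_le_norm (p u) (v - u))
  rw [abs_le]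
  constructor <;> linarith

/-- Co-coercivity of the gradient. The upper bound at `u` and the lower bound at `v` are compared at
the point reached from `u` by a step of length `M⁻¹` along `p v - p u`; the result is added to its
mirror image. -/
theorem sq_norm_sub_le (hM : 0 < M) (h : QuadraticBounds M F p) (u v : E) :
    ‖p u - p v‖ ^ 2 ≤ M * inner ℝ (p u - p v) (u - v) := by
  have key : ∀ u v : E, F v + inner ℝ (p v) (u - v) + (2 * M)⁻¹ * ‖p u - p v‖ ^ 2 ≤ F u := by
    intro u v
    set q := p u - p v with hq
    have h1 := h.lower v (u - M⁻¹ • q)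
    have h2 := h.upper u (u - M⁻¹ • q)
    have e1 : u - M⁻¹ • q - v = (u - v) - M⁻¹ • q := by abel
    have e2 : u - M⁻¹ • q - u = - (M⁻¹ • q) := by abel
    have e3 : inner ℝ (p u) q - inner ℝ (p v) q = ‖q‖ ^ 2 := by
      rw [← inner_sub_left, ← hq, real_inner_self_eq_norm_sq]
    rw [e1, inner_sub_right, inner_smul_right] at h1
    rw [e2, inner_neg_right, inner_smul_right, norm_neg, norm_smul, Real.norm_eq_abs,
      abs_of_pos (inv_pos.2 hM), mul_pow] at h2
    have e4 : M / 2 * (M⁻¹ ^ 2 * ‖q‖ ^ 2) = M⁻¹ * ‖q‖ ^ 2 / 2 := by field_simp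
    have e5 : (2 * M)⁻¹ * ‖q‖ ^ 2 = M⁻¹ * ‖q‖ ^ 2 / 2 := by field_simp
    have e6 : M⁻¹ * inner ℝ (p u) q - M⁻¹ * inner ℝ (p v) q = M⁻¹ * ‖q‖ ^ 2 := by
      rw [← mul_sub, e3]
    rw [e4] at h2
    rw [e5]
    linarith
  have h1 := key u v
  have h2 := key v u
  rw [← neg_sub u v, inner_neg_right, norm_sub_rev (p v)] at h2
  have h3 : 2 * ((2 * M)⁻¹ * ‖p u - p v‖ ^ 2) ≤ inner ℝ (p u - p v) (u - v) := by
    rw [inner_sub_left]; linarith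
  calc ‖p u - p v‖ ^ 2 = M * (2 * ((2 * M)⁻¹ * ‖p u - p v‖ ^ 2)) := by field_simp
    _ ≤ _ := mul_le_mul_of_nonneg_left h3 hM.le

theorem norm_sub_le (hM : 0 < M) (h : QuadraticBounds M F p) (u v : E) :
    ‖p u - p v‖ ≤ M * ‖u - v‖ := by
  have h1 := h.sq_norm_sub_le hM u v
  have h2 := real_inner_le_norm (p u - p v) (u - v)
  by_contra! hlt
  have hpos : 0 < ‖p u - p v‖ := (by positivity : 0 ≤ M * ‖u - v‖).trans_lt hlt
  nlinarith [mul_le_mul_of_nonneg_left h2 hM.le, mul_lt_mul_of_pos_left hlt hpos]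

theorem continuous_slope (hM : 0 < M) (h : QuadraticBounds M F p) : Continuous p :=
  (LipschitzWith.of_dist_le_mul (K := ⟨M, hM.le⟩) fun u v => by
    rw [dist_eq_norm, dist_eq_norm]; exact h.norm_sub_le hM u v).continuous

theorem norm_gradientStep_sub_le (hM : 0 < M) (h : QuadraticBounds M F p) {η : ℝ} (hη : 0 ≤ η)
    (hηM : η * M ≤ 2) (u v : E) :
    ‖(u - η • p u) - (v - η • p v)‖ ^ 2 ≤ ‖u - v‖ ^ 2 := by
  have e : (u - η • p u) - (v - η • p v) = (u - v) - η • (p u - p v) := by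
    rw [smul_sub]; abel
  rw [e, norm_sub_sq_real, inner_smul_right, norm_smul, Real.norm_eq_abs, mul_pow, sq_abs,
    real_inner_comm]
  have h1 := h.sq_norm_sub_le hM u v
  have h0 : 0 ≤ inner ℝ (p u - p v) (u - v) := by
    by_contra! hlt
    nlinarith [sq_nonneg ‖p u - p v‖, mul_neg_of_pos_of_neg hM hlt]
  have h2 : η ^ 2 * ‖p u - p v‖ ^ 2 ≤ η * (η * M * inner ℝ (p u - p v) (u - v)) := by
    nlinarith [mul_le_mul_of_nonneg_left h1 (sq_nonneg η)]
  have h3 : η * M * inner ℝ (p u - p v) (u - v) ≤ 2 * inner ℝ (p u - p v) (u - v) :=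
    mul_le_mul_of_nonneg_right hηM h0
  nlinarith [mul_le_mul_of_nonneg_left h3 hη]

/-- Progress of one averaged step with inexact gradients, relative to any comparison point. -/
theorem averagedStep_le (h : QuadraticBounds M F p) {K : ℕ} (hK : 1 ≤ K) {η : ℝ}
    (hη : 0 < η) (hηM : η * M ≤ 1 / 2) (x n : Fin K → E) (a b z : E)
    (ha : a = (K : ℝ)⁻¹ • ∑ k, x k)
    (hb : b = a - η • ((K : ℝ)⁻¹ • ∑ k, p (x k) + (K : ℝ)⁻¹ • ∑ k, n k)) :
    F b - F z ≤ (2 * η)⁻¹ * (‖a - z‖ ^ 2 - ‖b - z‖ ^ 2)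
      - inner ℝ ((K : ℝ)⁻¹ • ∑ k, n k) (a - z) + η * ‖(K : ℝ)⁻¹ • ∑ k, n k‖ ^ 2
      + M / 2 * ((K : ℝ)⁻¹ * ∑ k, ‖x k - a‖ ^ 2) := by
  have hK0 : (0 : ℝ) < K := by exact_mod_cast hK
  set P := (K : ℝ)⁻¹ • ∑ k, p (x k) with hP
  set N := (K : ℝ)⁻¹ • ∑ k, n k with hN
  have hsum : ∑ k, (x k - a) = 0 := by
    rw [Finset.sum_sub_distrib, Finset.sum_const, Finset.card_univ, Fintype.card_fin, ha,
      ← Nat.cast_smul_eq_nsmul ℝ, smul_inv_smul₀ hK0.ne', sub_self]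
  have h1 : ∀ k, F b - F z ≤ inner ℝ (p (x k)) (b - z)
      + M / 2 * (‖b - a‖ ^ 2 - 2 * inner ℝ (b - a) (x k - a) + ‖x k - a‖ ^ 2) := by
    intro k
    have l := h.lower (x k) z
    have u := h.upper (x k) b
    have e : inner ℝ (p (x k)) (b - z) = inner ℝ (p (x k)) (b - x k)
        - inner ℝ (p (x k)) (z - x k) := by
      rw [← inner_sub_right]; congr 1; abel
    have e' : ‖b - x k‖ ^ 2 = ‖b - a‖ ^ 2 - 2 * inner ℝ (b - a) (x k - a) + ‖x k - a‖ ^ 2 := by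
      rw [← norm_sub_sq_real]; congr 2; abel
    rw [e, ← e']
    linarith
  have h2 : F b - F z ≤ inner ℝ P (b - z)
      + M / 2 * (‖b - a‖ ^ 2 + (K : ℝ)⁻¹ * ∑ k, ‖x k - a‖ ^ 2) := by
    have hs := Finset.sum_le_sum (s := Finset.univ) fun k _ => h1 k
    rw [Finset.sum_const, Finset.card_univ, Fintype.card_fin, nsmul_eq_mul,
      Finset.sum_add_distrib, ← sum_inner, ← Finset.mul_sum, Finset.sum_add_distrib,
      Finset.sum_sub_distrib, ← Finset.mul_sum, ← inner_sum, hsum, inner_zero_right,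
      Finset.sum_const, Finset.card_univ, Fintype.card_fin, nsmul_eq_mul] at hs
    have hs' := mul_le_mul_of_nonneg_left hs (inv_pos.2 hK0).le
    rw [inv_mul_cancel_left₀ hK0.ne'] at hs'
    refine hs'.trans (le_of_eq ?_)
    rw [hP, real_inner_smul_left]
    field_simp
    ring
  have hba : b - a = -(η • (P + N)) := by rw [hb]; abel
  have h3 : inner ℝ (P + N) (b - z)
      = (2 * η)⁻¹ * (‖a - z‖ ^ 2 - ‖b - z‖ ^ 2 - ‖b - a‖ ^ 2) := by
    have e : ‖a - z‖ ^ 2 = ‖b - z‖ ^ 2 - 2 * inner ℝ (b - z) (b - a) + ‖b - a‖ ^ 2 := by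
      rw [← norm_sub_sq_real]; congr 2; abel
    rw [e, hba, inner_neg_right, inner_smul_right, real_inner_comm]
    field_simp
    ring
  have h4 : inner ℝ P (b - z) = inner ℝ (P + N) (b - z) - inner ℝ N (a - z)
      - inner ℝ N (b - a) := by
    rw [inner_add_left]
    have : b - z = (a - z) + (b - a) := by abel
    nth_rewrite 3 [this]
    rw [inner_add_right]; ring
  -- The three-point identity leaves `-(2 * η)⁻¹ * ‖b - a‖ ^ 2` to spend: one half pays for this
  -- Young inequality, the other for the smoothness term in `h6`, which is where `η * M ≤ 1 / 2`
  -- enters.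
  have h5 : -inner ℝ N (b - a) ≤ η * ‖N‖ ^ 2 + (4 * η)⁻¹ * ‖b - a‖ ^ 2 := by
    have hi := (abs_le.1 (abs_real_inner_le_norm N (b - a))).1
    have hq : 0 ≤ η * (‖N‖ - (2 * η)⁻¹ * ‖b - a‖) ^ 2 := by positivity
    have eq : η * (‖N‖ - (2 * η)⁻¹ * ‖b - a‖) ^ 2
        = η * ‖N‖ ^ 2 - ‖N‖ * ‖b - a‖ + (4 * η)⁻¹ * ‖b - a‖ ^ 2 := by
      field_simp; ring
    linarith
  have h6 : M / 2 * ‖b - a‖ ^ 2 ≤ (4 * η)⁻¹ * ‖b - a‖ ^ 2 := by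
    refine mul_le_mul_of_nonneg_right ?_ (sq_nonneg _)
    rw [← one_div, le_div_iff₀ (by positivity)]
    linarith
  have h7 : (2 * η)⁻¹ = (4 * η)⁻¹ + (4 * η)⁻¹ := by field_simp; norm_num
  have h8 : (2 * η)⁻¹ * (‖a - z‖ ^ 2 - ‖b - z‖ ^ 2 - ‖b - a‖ ^ 2)
      = (2 * η)⁻¹ * (‖a - z‖ ^ 2 - ‖b - z‖ ^ 2) - (4 * η)⁻¹ * ‖b - a‖ ^ 2
        - (4 * η)⁻¹ * ‖b - a‖ ^ 2 := by
    rw [mul_sub _ _ (‖b - a‖ ^ 2)]; nth_rewrite 2 [h7]; ring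
  rw [h4, h3, h8, mul_add] at h2
  linarith

end QuadraticBounds

/-! ### Averages over the nodes -/

/-- Jensen: the distance to the mean is at most the mean squared distance. -/
theorem sq_norm_sub_average_le {E : Type*} [NormedAddCommGroup E] [InnerProductSpace ℝ E]
    {K : ℕ} (hK : 1 ≤ K) (x : Fin K → E) (y : E) :
    ‖y - (K : ℝ)⁻¹ • ∑ l, x l‖ ^ 2 ≤ (K : ℝ)⁻¹ * ∑ l, ‖y - x l‖ ^ 2 := by
  have hK0 : (0 : ℝ) < K := by exact_mod_cast hK
  have e : y - (K : ℝ)⁻¹ • ∑ l, x l = (K : ℝ)⁻¹ • ∑ l, (y - x l) := by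
    rw [Finset.sum_sub_distrib, smul_sub, Finset.sum_const, Finset.card_univ, Fintype.card_fin,
      ← Nat.cast_smul_eq_nsmul ℝ, inv_smul_smul₀ hK0.ne']
  have h1 : ‖∑ l, (y - x l)‖ ^ 2 ≤ K * ∑ l, ‖y - x l‖ ^ 2 := by
    refine (pow_le_pow_left₀ (norm_nonneg _) (norm_sum_le _ _) 2).trans ?_
    simpa using sq_sum_le_card_mul_sum_sq (s := Finset.univ) (f := fun l => ‖y - x l‖)
  rw [e, norm_smul, mul_pow, norm_inv, Real.norm_natCast]
  calc _ ≤ (K : ℝ)⁻¹ ^ 2 * (K * ∑ l, ‖y - x l‖ ^ 2) :=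
        mul_le_mul_of_nonneg_left h1 (by positivity)
    _ = _ := by field_simp

namespace QuadraticBounds

variable {E : Type*} [NormedAddCommGroup E] [InnerProductSpace ℝ E]

theorem mono {M M' : ℝ} {F : E → ℝ} {p : E → E} (h : QuadraticBounds M F p) (hM : M ≤ M') :
    QuadraticBounds M' F p where
  lower := h.lower
  upper u v := (h.upper u v).trans (by gcongr)

theorem average {K : ℕ} (hK : 1 ≤ K) {M : ℝ} {F : Fin K → E → ℝ} {p : Fin K → E → E}
    (h : ∀ k, QuadraticBounds M (F k) (p k)) :
    QuadraticBounds M (fun w => (K : ℝ)⁻¹ * ∑ k, F k w)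
      (fun w => (K : ℝ)⁻¹ • ∑ k, p k w) := by
  have hK0 : (0 : ℝ) < K := by exact_mod_cast hK
  constructor
  · intro u v
    rw [real_inner_smul_left, ← mul_add, sum_inner, ← Finset.sum_add_distrib]
    exact mul_le_mul_of_nonneg_left (Finset.sum_le_sum fun k _ => (h k).lower u v)
      (inv_pos.2 hK0).le
  · intro u v
    have h1 := mul_le_mul_of_nonneg_left (Finset.sum_le_sum (s := Finset.univ)
      fun k _ => (h k).upper u v) (inv_pos.2 hK0).le
    rw [Finset.sum_add_distrib, Finset.sum_add_distrib, Finset.sum_const, Finset.card_univ,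
      Fintype.card_fin, nsmul_eq_mul, mul_add, mul_add, inv_mul_cancel_left₀ hK0.ne'] at h1
    rwa [real_inner_smul_left, sum_inner]

end QuadraticBounds

/-! ### Weighted integrals of convex smooth functions -/

section Integral

variable {d : ℕ} {Z : Type*} [MeasurableSpace Z] {P : Measure Z} {β : ℝ}
  {φ : EuclideanSpace ℝ (Fin d) → Z → ℝ}

/-- Measurability in `z` is known only for the values at fixed `w`; it passes to directional
derivatives as limits of difference quotients. -/
theorem aestronglyMeasurable_inner_gradient
    (hd : ∀ z, Differentiable ℝ (φ · z))
    (hm : ∀ w, AEStronglyMeasurable (φ w) P) (w v : EuclideanSpace ℝ (Fin d)) :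
    AEStronglyMeasurable (fun z => inner ℝ (gradient (φ · z) w) v) P := by
  have hlim : ∀ z, Filter.Tendsto
      (fun n : ℕ => (n : ℝ) • (φ (w + (n : ℝ)⁻¹ • v) z - φ w z)) Filter.atTop
      (nhds (inner ℝ (gradient (φ · z) w) v)) := by
    intro z
    rw [inner_gradient_left]
    refine (hd z w).hasFDerivAt.lim v ?_
    simpa using tendsto_natCast_atTop_atTop (R := ℝ)
  refine aestronglyMeasurable_of_tendsto_ae Filter.atTop (f := fun (n : ℕ) z =>
    (n : ℝ) • (φ (w + (n : ℝ)⁻¹ • v) z - φ w z)) (fun n => ?_)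
    (Filter.Eventually.of_forall hlim)
  exact AEStronglyMeasurable.const_smul ((hm _).sub (hm _)) (n : ℝ)

theorem integrable_weighted_gradient {c : Z → ℝ} (hφ : ∀ z, ConvexSmooth β (φ · z))
    (hm : ∀ w, AEStronglyMeasurable (φ w) P) (hc0 : ∀ z, 0 ≤ c z) (hc : Integrable c P)
    (hi : ∀ w, Integrable (fun z => c z * φ w z) P) (w : EuclideanSpace ℝ (Fin d)) :
    Integrable (fun z => c z • gradient (φ · z) w) P := by
  -- Convexity squeezes the directional derivative between `φ w z - φ (w - v) z` and `φ (w + v) z -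
  -- φ w z`, so finite risks already provide an integrable majorant.
  have hcomp : ∀ v, Integrable (fun z => c z * inner ℝ (gradient (φ · z) w) v) P := by
    intro v
    refine Integrable.mono' (((hi (w + v)).abs.add (hi (w - v)).abs).add (hi w).abs)
      (hc.1.mul (aestronglyMeasurable_inner_gradient (fun z => (hφ z).differentiable) hm w v))
      (Filter.Eventually.of_forall fun z => ?_)
    have h1 := (hφ z).quadraticBounds.lower w (w + v)
    have h2 := (hφ z).quadraticBounds.lower w (w - v)
    rw [add_sub_cancel_left] at h1
    rw [sub_sub_cancel_left, inner_neg_right] at h2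
    have h1' := mul_le_mul_of_nonneg_left h1 (hc0 z)
    have h2' := mul_le_mul_of_nonneg_left h2 (hc0 z)
    have b1 := le_abs_self (c z * φ (w + v) z)
    have b2 := le_abs_self (c z * φ (w - v) z)
    have b3 := neg_abs_le (c z * φ w z)
    have b4 := abs_nonneg (c z * φ (w + v) z)
    have b5 := abs_nonneg (c z * φ (w - v) z)
    simp only [Pi.add_apply]
    rw [Real.norm_eq_abs, abs_le]
    constructor <;> linarith
  have hsum : (fun z => c z • gradient (φ · z) w) = fun z => ∑ i,
      (c z * inner ℝ (gradient (φ · z) w) (EuclideanSpace.basisFun (Fin d) ℝ i)) •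
        EuclideanSpace.basisFun (Fin d) ℝ i := by
    funext z
    conv_lhs => rw [← (EuclideanSpace.basisFun (Fin d) ℝ).sum_repr (gradient (φ · z) w)]
    rw [Finset.smul_sum]
    refine Finset.sum_congr rfl fun i _ => ?_
    rw [OrthonormalBasis.repr_apply_apply, real_inner_comm, smul_smul]
  rw [hsum]
  exact integrable_finsetSum _ fun i _ => (hcomp _).smul_const _

theorem ConvexSmooth.quadraticBounds_integral {c : Z → ℝ}
    (hφ : ∀ z, ConvexSmooth β (φ · z)) (hm : ∀ w, AEStronglyMeasurable (φ w) P)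
    (hc0 : ∀ z, 0 ≤ c z) (hc : Integrable c P)
    (hi : ∀ w, Integrable (fun z => c z * φ w z) P) :
    QuadraticBounds (2 * β * ∫ z, c z ∂P) (fun w => ∫ z, c z * φ w z ∂P)
      (fun w => ∫ z, c z • gradient (φ · z) w ∂P) := by
  have hg := integrable_weighted_gradient hφ hm hc0 hc hi
  have hin : ∀ u v, Integrable (fun z => inner ℝ v (c z • gradient (φ · z) u)) P :=
    fun u v => (hg u).const_inner v
  constructor
  · intro u v
    rw [real_inner_comm, ← integral_inner (hg u), ← integral_add (hi u) (hin u _)]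
    refine integral_mono ((hi u).add (hin u _)) (hi v) fun z => ?_
    have := mul_le_mul_of_nonneg_left ((hφ z).quadraticBounds.lower u v) (hc0 z)
    dsimp only
    rw [inner_smul_right, real_inner_comm]
    linarith
  · intro u v
    rw [real_inner_comm, ← integral_inner (hg u), ← integral_add (hi u) (hin u _)]
    have e : 2 * β * (∫ z, c z ∂P) / 2 * ‖v - u‖ ^ 2 = ∫ z, c z * (β * ‖v - u‖ ^ 2) ∂P := by
      rw [integral_mul_const]; ring
    have hs : Integrable
        (fun z => c z * φ u z + inner ℝ (v - u) (c z • gradient (φ · z) u)) P :=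
      (hi u).add (hin u _)
    rw [e, ← integral_add hs (hc.mul_const _)]
    refine integral_mono (hi v) (hs.add (hc.mul_const _)) fun z => ?_
    have := mul_le_mul_of_nonneg_left ((hφ z).quadraticBounds.upper u v) (hc0 z)
    simp only
    rw [inner_smul_right, real_inner_comm]
    linarith

end Integral

/-! ### Smoothness of the importance weighted risk -/

namespace MultiNode

variable {d K : ℕ} {X Y V Θ : Type*} [MeasurableSpace X] [MeasurableSpace Y] [Fintype Y]

theorem sum_labelMarginal_mul_aggregate {S : MultiNode d K X Y V Θ} (hS : S.Regular)
    {ρ : Fin K → Y → ℝ} (hρ : ∀ k, ρ k ∈ S.ratioSet k) (k : Fin K) :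
    ∑ y, S.labelMarginal k y * S.aggregate ρ k y = K := by
  have h : ∀ y, S.labelMarginal k y * S.aggregate ρ k y = ∑ j, ρ j y * S.labelMarginal j y :=
    fun y => mul_div_cancel₀ _ (hS.marginal_pos k y).ne'
  simp_rw [h]
  rw [Finset.sum_comm, Finset.sum_congr rfl fun j _ => (hρ j).2]
  simp

theorem aggregate_nonneg {S : MultiNode d K X Y V Θ} (hS : S.Regular)
    {ρ : Fin K → Y → ℝ} (hρ : ∀ k, ρ k ∈ S.ratioSet k) (k : Fin K) (y : Y) :
    0 ≤ S.aggregate ρ k y :=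
  div_nonneg (Finset.sum_nonneg fun j _ => mul_nonneg ((hρ j).1 y) (hS.marginal_pos j y).le)
    (hS.marginal_pos k y).le

/-- The aggregated ratios have mean `K ≥ 1` under the label marginal, so they cannot all be
nonpositive. -/
theorem pos_of_aggregate_le {S : MultiNode d K X Y V Θ} (hS : S.Regular) (hK : 1 ≤ K)
    {ρ : Fin K → Y → ℝ} (hρ : ∀ k, ρ k ∈ S.ratioSet k) {r : ℝ}
    (hr : ∀ k y, S.aggregate ρ k y ≤ r) : 0 < r := by
  by_contra! hle
  have h := S.sum_labelMarginal_mul_aggregate hS hρ ⟨0, hK⟩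
  have h0 : ∑ y, S.labelMarginal ⟨0, hK⟩ y * S.aggregate ρ ⟨0, hK⟩ y ≤ 0 :=
    Finset.sum_nonpos fun y _ => mul_nonpos_of_nonneg_of_nonpos (hS.marginal_pos _ y).le
      ((hr _ y).trans hle)
  rw [h] at h0
  have : (1 : ℝ) ≤ K := by exact_mod_cast hK
  linarith

theorem exists_quadraticBounds_risk [MeasurableSingletonClass Y] {S : MultiNode d K X Y V Θ}
    (hS : S.Regular) (hK : 1 ≤ K) {β : ℝ} (hβ : 0 ≤ β)
    (hφ : ∀ x y, ConvexSmooth β (fun w => S.loss (S.model w x) y))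
    {ρ : Fin K → Y → ℝ} (hρ : ∀ k, ρ k ∈ S.ratioSet k) {r : ℝ}
    (hr : ∀ k y, S.aggregate ρ k y ≤ r) :
    ∃ p, QuadraticBounds (2 * β * r) (S.risk ρ) p := by
  refine ⟨_, QuadraticBounds.average hK (F := fun k w => S.nodeRisk ρ k w)
    (p := fun k w => ∫ z, S.aggregate ρ k z.2 •
      gradient (fun w => S.loss (S.model w z.1) z.2) w ∂(S.train k)) fun k => ?_⟩
  have := hS.isProb k
  have hmeas : Measurable fun z : X × Y => S.aggregate ρ k z.2 :=
    (measurable_of_finite (S.aggregate ρ k)).comp measurable_snd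
  have hb : ∀ z : X × Y, ‖S.aggregate ρ k z.2‖ ≤ r := fun z => by
    rw [Real.norm_of_nonneg (aggregate_nonneg hS hρ k z.2)]; exact hr k z.2
  have hc : Integrable (fun z : X × Y => S.aggregate ρ k z.2) (S.train k) :=
    Integrable.of_bound hmeas.aestronglyMeasurable r (Filter.Eventually.of_forall hb)
  refine (ConvexSmooth.quadraticBounds_integral
    (φ := fun w z => S.loss (S.model w z.1) z.2) (c := fun z : X × Y => S.aggregate ρ k z.2)
    (fun z => hφ z.1 z.2) (fun w => (hS.integrable_loss k w).1)
    (fun z => aggregate_nonneg hS hρ k z.2) hc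
    (fun w => (hS.integrable_loss k w).bdd_mul hmeas.aestronglyMeasurable
      (Filter.Eventually.of_forall hb))).mono ?_
  refine mul_le_mul_of_nonneg_left ?_ (by positivity)
  calc ∫ z, S.aggregate ρ k z.2 ∂(S.train k) ≤ ∫ _, r ∂(S.train k) :=
        integral_mono hc (integrable_const r) fun z => hr k z.2
    _ = r := by simp

end MultiNode

/-! ### Gradient noise at independent samples -/

theorem MeasureTheory.MemLp.integrable_inner_real {Ω E : Type*} [MeasurableSpace Ω]
    {μ : Measure Ω} [NormedAddCommGroup E] [InnerProductSpace ℝ E] {f g : Ω → E}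
    (hf : MemLp f 2 μ) (hg : MemLp g 2 μ) : Integrable (fun ω => inner ℝ (f ω) (g ω)) μ := by
  refine Integrable.mono' (hf.norm.integrable_mul hg.norm) (hf.1.inner hg.1)
    (Filter.Eventually.of_forall fun ω => ?_)
  exact norm_inner_le_norm _ _

section Independence

variable {Ω Ξ ι : Type*} [MeasurableSpace Ξ]

/-- The σ-algebra generated by the samples with index in `S`. -/
@[reducible] def sampleAlgebra (ξ : ι → Ω → Ξ) (S : Set ι) : MeasurableSpace Ω :=
  ⨆ i ∈ S, MeasurableSpace.comap (ξ i) inferInstance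

theorem measurable_sampleAlgebra (ξ : ι → Ω → Ξ) {S : Set ι} {i : ι} (hi : i ∈ S) :
    Measurable[sampleAlgebra ξ S] (ξ i) :=
  measurable_iff_comap_le.2
    (le_iSup₂ (f := fun i (_ : i ∈ S) => MeasurableSpace.comap (ξ i) inferInstance) i hi)

variable [MeasurableSpace Ω] {μ : Measure Ω}

theorem sampleAlgebra_le {ξ : ι → Ω → Ξ} (hξ : ∀ i, Measurable (ξ i)) (S : Set ι) :
    sampleAlgebra ξ S ≤ ‹MeasurableSpace Ω› :=
  iSup₂_le fun i _ => (hξ i).comap_le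

theorem indepFun_of_measurable_sampleAlgebra {ξ : ι → Ω → Ξ} (hξ : ∀ i, Measurable (ξ i))
    (hind : iIndepFun ξ μ) {S : Set ι} {i : ι} (hi : i ∉ S) {β : Type*} [MeasurableSpace β]
    {f : Ω → β} (hf : Measurable[sampleAlgebra ξ S] f) : IndepFun f (ξ i) μ := by
  rw [IndepFun_iff_Indep]
  have h := indep_iSup_of_disjoint (fun i => (hξ i).comap_le) hind.iIndep
    (S := S) (T := {i}) (Set.disjoint_singleton_right.2 hi)
  refine indep_of_indep_of_le_left (indep_of_indep_of_le_right h ?_)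
    (measurable_iff_comap_le.1 hf)
  simp

end Independence

namespace StochasticGradient

variable {d : ℕ} {Ω Ξ : Type*} [MeasurableSpace Ω] [MeasurableSpace Ξ] {μ : Measure Ω}
  [IsProbabilityMeasure μ] {ν : Measure Ξ} {σ : ℝ} {F : EuclideanSpace ℝ (Fin d) → ℝ}
  {g : EuclideanSpace ℝ (Fin d) → Ξ → EuclideanSpace ℝ (Fin d)}
  {X : Ω → EuclideanSpace ℝ (Fin d)} {ζ : Ω → Ξ}

theorem integrable_sq_noise (h : StochasticGradient ν σ F g) (hF : Measurable (gradient F))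
    (hX : Measurable X) (hζ : Measurable ζ) (hν : μ.map ζ = ν) (hind : IndepFun X ζ μ) :
    Integrable (fun ω => ‖g (X ω) (ζ ω) - gradient F (X ω)‖ ^ 2) μ ∧
      ∫ ω, ‖g (X ω) (ζ ω) - gradient F (X ω)‖ ^ 2 ∂μ ≤ σ ^ 2 := by
  have : IsProbabilityMeasure ν := hν ▸ Measure.isProbabilityMeasure_map hζ.aemeasurable
  have : IsProbabilityMeasure (μ.map X) := Measure.isProbabilityMeasure_map hX.aemeasurable
  have hmap := hind.map_prod_eq_prod_map_map hX.aemeasurable hζ.aemeasurable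
  rw [hν] at hmap
  set H : EuclideanSpace ℝ (Fin d) × Ξ → ℝ := fun q => ‖g q.1 q.2 - gradient F q.1‖ ^ 2 with hH
  have hHm : Measurable H :=
    ((h.measurable.sub (hF.comp measurable_fst)).norm).pow_const 2
  have hXζ : Measurable fun ω => (X ω, ζ ω) := hX.prodMk hζ
  have hle : ∀ x, ∫ s, H (x, s) ∂ν ≤ σ ^ 2 := fun x => h.variance_le x
  have hnn : ∀ x, 0 ≤ ∫ s, H (x, s) ∂ν := fun x => integral_nonneg fun s => sq_nonneg _
  have hint : Integrable H ((μ.map X).prod ν) := by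
    rw [integrable_prod_iff hHm.aestronglyMeasurable]
    refine ⟨Filter.Eventually.of_forall fun x => h.integrable_sq x, ?_⟩
    refine Integrable.of_bound
      hHm.aestronglyMeasurable.norm.integral_prod_right' (σ ^ 2)
      (Filter.Eventually.of_forall fun x => ?_)
    have e : ∫ s, ‖H (x, s)‖ ∂ν = ∫ s, H (x, s) ∂ν := by
      congr 1; funext s; exact Real.norm_of_nonneg (sq_nonneg _)
    rw [e, Real.norm_of_nonneg (hnn x)]
    exact hle x
  constructor
  · rw [← hmap] at hint
    exact hint.comp_measurable hXζ
  · have e : ∫ ω, H (X ω, ζ ω) ∂μ = ∫ x, ∫ s, H (x, s) ∂ν ∂(μ.map X) := by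
      rw [← integral_prod _ hint, ← hmap,
        integral_map hXζ.aemeasurable hHm.aestronglyMeasurable]
    calc ∫ ω, H (X ω, ζ ω) ∂μ = ∫ x, ∫ s, H (x, s) ∂ν ∂(μ.map X) := e
      _ ≤ ∫ _, σ ^ 2 ∂(μ.map X) :=
        integral_mono hint.integral_prod_left (integrable_const _) hle
      _ = σ ^ 2 := by simp

theorem memLp_noise (h : StochasticGradient ν σ F g) (hF : Measurable (gradient F))
    (hX : Measurable X) (hζ : Measurable ζ) (hν : μ.map ζ = ν) (hind : IndepFun X ζ μ) :
    MemLp (fun ω => g (X ω) (ζ ω) - gradient F (X ω)) 2 μ :=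
  (memLp_two_iff_integrable_sq_norm ((h.measurable.comp (hX.prodMk hζ)).sub
    (hF.comp hX)).aestronglyMeasurable).2 (h.integrable_sq_noise hF hX hζ hν hind).1

/-- By independence the joint law is a product, and integrating over the sample first kills the
centred noise. Allowing a general `Z` covers past iterates, current gradients and the noise of other
nodes. -/
theorem integral_inner_noise_eq_zero (h : StochasticGradient ν σ F g)
    (hF : Measurable (gradient F)) (hX : Measurable X) (hζ : Measurable ζ) (hν : μ.map ζ = ν)
    {Z : Ω → EuclideanSpace ℝ (Fin d)} (hZ : Measurable Z) (hZ2 : MemLp Z 2 μ)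
    (hind : IndepFun (fun ω => (X ω, Z ω)) ζ μ) :
    ∫ ω, inner ℝ (g (X ω) (ζ ω) - gradient F (X ω)) (Z ω) ∂μ = 0 := by
  have : IsProbabilityMeasure ν := hν ▸ Measure.isProbabilityMeasure_map hζ.aemeasurable
  have hXZ : Measurable fun ω => (X ω, Z ω) := hX.prodMk hZ
  have : IsProbabilityMeasure (μ.map fun ω => (X ω, Z ω)) :=
    Measure.isProbabilityMeasure_map hXZ.aemeasurable
  have hindX : IndepFun X ζ μ := hind.comp measurable_fst measurable_id
  have hmap := hind.map_prod_eq_prod_map_map hXZ.aemeasurable hζ.aemeasurable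
  rw [hν] at hmap
  set H : (EuclideanSpace ℝ (Fin d) × EuclideanSpace ℝ (Fin d)) × Ξ → ℝ :=
    fun q => inner ℝ (g q.1.1 q.2 - gradient F q.1.1) q.1.2 with hH
  have hHm : Measurable H :=
    ((h.measurable.comp ((measurable_fst.comp measurable_fst).prodMk measurable_snd)).sub
      (hF.comp (measurable_fst.comp measurable_fst))).inner (measurable_snd.comp measurable_fst)
  have hall : Measurable fun ω => ((X ω, Z ω), ζ ω) := hXZ.prodMk hζ
  have hint : Integrable H ((μ.map fun ω => (X ω, Z ω)).prod ν) := by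
    rw [← hmap, integrable_map_measure hHm.aestronglyMeasurable hall.aemeasurable]
    exact (h.memLp_noise hF hX hζ hν hindX).integrable_inner_real hZ2
  have e : ∫ ω, H ((X ω, Z ω), ζ ω) ∂μ
      = ∫ x, ∫ s, H (x, s) ∂ν ∂(μ.map fun ω => (X ω, Z ω)) := by
    rw [← integral_prod _ hint, ← hmap,
      integral_map hall.aemeasurable hHm.aestronglyMeasurable]
  refine e.trans ?_
  have h0 : ∀ x, ∫ s, H (x, s) ∂ν = 0 := by
    intro x
    have hi := (h.integrable x.1).sub (integrable_const (gradient F x.1))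
    calc ∫ s, H (x, s) ∂ν = ∫ s, inner ℝ x.2 (g x.1 s - gradient F x.1) ∂ν := by
          congr 1; funext s; exact real_inner_comm _ _
      _ = inner ℝ x.2 (∫ s, (g x.1 s - gradient F x.1) ∂ν) := integral_inner hi _
      _ = 0 := by
        rw [integral_sub (h.integrable x.1) (integrable_const _), h.unbiased]
        simp
  simp [h0]

end StochasticGradient

/-- Only samples before time `T` are assumed measurable, so that `Ω` may carry the σ-algebra
generated by the past: this is how adaptedness of the iterates is obtained. -/
theorem measurable_localSGD {d K : ℕ} {Ω Ξ : Type*} [MeasurableSpace Ω] [MeasurableSpace Ξ]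
    {g : Fin K → EuclideanSpace ℝ (Fin d) → Ξ → EuclideanSpace ℝ (Fin d)}
    (hg : ∀ k, Measurable (Function.uncurry (g k))) (τ : ℕ) (η : ℝ)
    (w₀ : EuclideanSpace ℝ (Fin d)) {ξ : Fin K → ℕ → Ω → Ξ} {T : ℕ}
    (hξ : ∀ k s, s < T → Measurable (ξ k s)) (t : ℕ) (ht : t ≤ T) (k : Fin K) :
    Measurable fun ω => localSGD τ η g w₀ (fun k t => ξ k t ω) t k := by
  induction t generalizing k with
  | zero => exact measurable_const
  | succ t ih =>
    have hstep : ∀ k, Measurable fun ω => localSGD τ η g w₀ (fun k t => ξ k t ω) t k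
        - η • g k (localSGD τ η g w₀ (fun k t => ξ k t ω) t k) (ξ k t ω) := fun k =>
      (ih (by omega) k).sub
        (((hg k).comp ((ih (by omega) k).prodMk (hξ k t (by omega)))).const_smul η)
    simp only [localSGD]
    split_ifs
    · exact Measurable.const_smul (Finset.measurable_sum _ fun k _ => hstep k) ((K : ℝ)⁻¹)
    · exact hstep k

/-! ### From averages to the last iterate -/

/-- From suffix averages to the last term: `c i` is the `i`-th term counted from the last. -/
theorem le_average_add_harmonic {c : ℕ → ℝ} {e : ℝ} {T : ℕ}
    (h : ∀ m, m < T → ∑ i ∈ Finset.range m, c i ≤ m * (c m + e)) {m : ℕ} (hm : 1 ≤ m)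
    (hmT : m ≤ T) :
    c 0 ≤ (∑ i ∈ Finset.range m, c i) / m + e * ((harmonic m : ℚ) - 1 : ℝ) := by
  induction m, hm using Nat.le_induction with
  | base => simp
  | succ m hm ih =>
    have hm0 : (0 : ℝ) < m := by exact_mod_cast hm
    have h1 := ih (by omega)
    have h2 := h m (by omega)
    rw [harmonic_succ, Finset.sum_range_succ]
    push_cast
    have h3 : (∑ i ∈ Finset.range m, c i) / m - e ≤ c m := by
      rw [sub_le_iff_le_add, div_le_iff₀ hm0]; linarith
    -- Including the term `c m`, which is at least the current average minus `e`, lowers the average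
    -- by at most `e / (m + 1)`. These losses add up to the harmonic number without its first term.
    have h4 : (∑ i ∈ Finset.range m, c i) / m - e / (m + 1)
        ≤ ((∑ i ∈ Finset.range m, c i) + c m) / (m + 1) := by
      have e1 : (∑ i ∈ Finset.range m, c i) / m - e / (m + 1)
          = ((∑ i ∈ Finset.range m, c i) + ((∑ i ∈ Finset.range m, c i) / m - e)) / (m + 1) := by
        field_simp; ring
      rw [e1]
      gcongr
    have e2 : e * (((harmonic m : ℚ) : ℝ) + ((m : ℝ) + 1)⁻¹ - 1)
        = e * (((harmonic m : ℚ) : ℝ) - 1) + e / (m + 1) := by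
      rw [div_eq_mul_inv]; ring
    rw [e2]
    linarith

theorem last_le_average_add_log {c : ℕ → ℝ} {e B : ℝ} (he : 0 ≤ e) {T : ℕ} (hT : 1 ≤ T)
    (h : ∀ m, m < T → ∑ i ∈ Finset.range m, c i ≤ m * (c m + e))
    (hB : ∑ i ∈ Finset.range T, c i ≤ B + T * e) :
    c 0 ≤ B / T + e * (1 + Real.log T) := by
  have hT0 : (0 : ℝ) < T := by exact_mod_cast hT
  have h1 := le_average_add_harmonic h hT le_rfl
  have h2 : (∑ i ∈ Finset.range T, c i) / T ≤ B / T + e := by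
    rw [div_le_iff₀ hT0, add_mul, div_mul_cancel₀ _ hT0.ne']; linarith
  have h3 := mul_le_mul_of_nonneg_left (harmonic_le_one_add_log T) he
  linarith

/-! ### Choice of the step size -/

/-- The step size balancing the three error terms of local SGD. -/
noncomputable def balancedStep (L D K τ T : ℝ) : ℝ :=
  min (1 / (4 * L)) (min (D * Real.sqrt (K / T)) ((D ^ 2 / (L * τ * T)) ^ ((1 : ℝ) / 3)))

theorem balancedStep_pos {L D K τ T : ℝ} (hL : 0 < L) (hD : 0 < D) (hK : 0 < K) (hτ : 0 < τ)
    (hT : 0 < T) : 0 < balancedStep L D K τ T := by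
  unfold balancedStep
  refine lt_min (by positivity) (lt_min ?_ ?_)
  · exact mul_pos hD (Real.sqrt_pos.2 (by positivity))
  · exact Real.rpow_pos_of_pos (by positivity) _

theorem Real.rpow_third_pow_three {x : ℝ} (hx : 0 ≤ x) : (x ^ ((1 : ℝ) / 3)) ^ 3 = x := by
  rw [← Real.rpow_natCast, ← Real.rpow_mul hx]
  norm_num

theorem balancedStep_error_le {σ L D K τ R : ℝ} (hL : 0 < L) (hD : 0 < D) (hK : 0 < K)
    (hτ : 1 ≤ τ) (hR : 1 ≤ R) {η : ℝ} (hη : η = balancedStep L D K τ (τ * R)) :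
    D ^ 2 / (2 * η) / (τ * R)
        + (η * σ ^ 2 / K + 2 * L * τ * η ^ 2 * σ ^ 2) * (1 + Real.log (τ * R))
      ≤ (2 + 2 * σ ^ 2) * (1 + Real.log (τ * R)) *
        (L * D ^ 2 / (τ * R)
          + (L * D ^ 4) ^ ((1 : ℝ) / 3) / (Real.sqrt τ * R) ^ ((2 : ℝ) / 3)
          + D / Real.sqrt (K * τ * R)) := by
  have hτ0 : 0 < τ := by linarith
  have hR0 : 0 < R := by linarith
  have hη0 : 0 < η := hη ▸ balancedStep_pos hL hD hK hτ0 (by positivity)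
  set T := τ * R with hT
  have hT0 : 0 < T := by positivity
  have hT1 : 1 ≤ T := by rw [hT]; nlinarith
  have hlog : 0 ≤ Real.log T := Real.log_nonneg hT1
  set q := (D ^ 2 / (L * τ * T)) ^ ((1 : ℝ) / 3) with hq
  have hq0 : 0 < q := Real.rpow_pos_of_pos (by positivity) _
  have hq3 : q ^ 3 = D ^ 2 / (L * τ * T) := Real.rpow_third_pow_three (by positivity)
  set s := D * Real.sqrt (K / T) with hs
  have hs0 : 0 < s := mul_pos hD (Real.sqrt_pos.2 (by positivity))
  set Q := (L * D ^ 4) ^ ((1 : ℝ) / 3) / (Real.sqrt τ * R) ^ ((2 : ℝ) / 3) with hQ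
  have hQ0 : 0 ≤ Q := by positivity
  have hQ3 : Q ^ 3 = L * D ^ 4 / (τ * R ^ 2) := by
    rw [hQ, div_pow, Real.rpow_third_pow_three (by positivity), ← Real.rpow_natCast (_ ^ _),
      ← Real.rpow_mul (by positivity)]
    norm_num
    rw [mul_pow, Real.sq_sqrt hτ0.le]
  -- `q` is the step size at which `D ^ 2 / (T * η)` and the drift `L * τ * η ^ 2` agree; `Q` is
  -- their common value. Likewise `s` equalises `D ^ 2 / (T * η)` and `η / K`, with common value
  -- `W`.
  have hQ1 : D ^ 2 / (T * q) = Q := by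
    refine (pow_left_inj₀ (by positivity) hQ0 three_ne_zero).1 ?_
    rw [hQ3, div_pow, mul_pow, hq3, hT]
    field_simp
  have hQ2 : L * τ * q ^ 2 = Q := by
    rw [← hQ1, eq_div_iff (by positivity)]
    calc L * τ * q ^ 2 * (T * q) = L * τ * T * q ^ 3 := by ring
      _ = D ^ 2 := by rw [hq3]; field_simp
  set W := D / Real.sqrt (K * τ * R) with hW
  have hsq : Real.sqrt (K * τ * R) = Real.sqrt K * Real.sqrt T := by
    rw [← Real.sqrt_mul hK.le, hT, mul_assoc]
  have hKs := Real.sqrt_pos.2 hK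
  have hTs := Real.sqrt_pos.2 hT0
  have hKK := Real.sq_sqrt hK.le
  have hTT := Real.sq_sqrt hT0.le
  have hsD : s = D * Real.sqrt K / Real.sqrt T := by rw [hs, Real.sqrt_div hK.le]; ring
  have hW0 : 0 ≤ W := by positivity
  have hW1 : s / K = W := by
    rw [hsD, hW, hsq]; nth_rewrite 2 [← hKK]; field_simp
  have hW2 : D ^ 2 / (T * s) = W := by
    rw [hsD, hW, hsq]; nth_rewrite 1 [← hTT]; field_simp
  have hb1 : η ≤ s := hη ▸ (min_le_right _ _).trans (min_le_left _ _)
  have hb2 : η ≤ q := hη ▸ (min_le_right _ _).trans (min_le_right _ _)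
  have hinv : 1 / η ≤ 4 * L + 1 / s + 1 / q := by
    have p1 : 0 < 1 / s := by positivity
    have p2 : 0 < 1 / q := by positivity
    rcases min_choice (1 / (4 * L)) (min s q) with h | h
    · have : η = 1 / (4 * L) := hη.trans h
      rw [this, one_div_one_div]; linarith
    · rcases min_choice s q with h' | h'
      · have : η = s := hη.trans (h.trans h')
        rw [this]; linarith
      · have : η = q := hη.trans (h.trans h')
        rw [this]; linarith
  have hA0 : 0 ≤ L * D ^ 2 / T := by positivity
  have h1 : D ^ 2 / (2 * η) / T ≤ 2 * (L * D ^ 2 / T + Q + W) := by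
    calc D ^ 2 / (2 * η) / T = D ^ 2 / (2 * T) * (1 / η) := by field_simp
      _ ≤ D ^ 2 / (2 * T) * (4 * L + 1 / s + 1 / q) := by gcongr
      _ = 2 * (L * D ^ 2 / T) + D ^ 2 / (T * s) / 2 + D ^ 2 / (T * q) / 2 := by
        field_simp; ring
      _ ≤ _ := by rw [hQ1, hW2]; linarith
  have h2 : η * σ ^ 2 / K ≤ σ ^ 2 * W := by
    calc η * σ ^ 2 / K ≤ s * σ ^ 2 / K := by gcongr
      _ = σ ^ 2 * W := by rw [← hW1]; ring
  have h3 : 2 * L * τ * η ^ 2 * σ ^ 2 ≤ 2 * σ ^ 2 * Q := by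
    calc 2 * L * τ * η ^ 2 * σ ^ 2 ≤ 2 * L * τ * q ^ 2 * σ ^ 2 := by gcongr
      _ = 2 * σ ^ 2 * Q := by rw [← hQ2]; ring
  have hS0 : 0 ≤ L * D ^ 2 / T + Q + W := by positivity
  have h4 : η * σ ^ 2 / K + 2 * L * τ * η ^ 2 * σ ^ 2
      ≤ 2 * σ ^ 2 * (L * D ^ 2 / T + Q + W) := by
    nlinarith [mul_nonneg (sq_nonneg σ) hA0, mul_nonneg (sq_nonneg σ) hW0]
  calc _ ≤ 2 * (L * D ^ 2 / T + Q + W) * (1 + Real.log T)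
        + 2 * σ ^ 2 * (L * D ^ 2 / T + Q + W) * (1 + Real.log T) := by
        refine add_le_add (h1.trans ?_) (mul_le_mul_of_nonneg_right h4 (by linarith))
        exact le_mul_of_one_le_right (by linarith) (by linarith)
    _ = _ := by ring

/-! ### Local descent with orthogonal noise -/

/-- Square integrable iterates `x t k` of local gradient descent with slopes `p`, perturbed by
noise `n t k` of variance at most `σ ^ 2` that is orthogonal to the past and across nodes. -/
structure LocalDescent {Ω E : Type*} [MeasurableSpace Ω] (μ : Measure Ω) [NormedAddCommGroup E]
    [InnerProductSpace ℝ E] {K : ℕ} (τ : ℕ) (η σ : ℝ) (p : E → E) (w₀ : E)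
    (x n : ℕ → Fin K → Ω → E) : Prop where
  memLp_iterate : ∀ t k, MemLp (x t k) 2 μ
  memLp_slope : ∀ t k, MemLp (fun ω => p (x t k ω)) 2 μ
  memLp_noise : ∀ t k, MemLp (n t k) 2 μ
  variance_le : ∀ t k, ∫ ω, ‖n t k ω‖ ^ 2 ∂μ ≤ σ ^ 2
  orth_const : ∀ t k z, ∫ ω, inner ℝ (n t k ω) z ∂μ = 0
  orth_iterate : ∀ t k s l, s ≤ t → ∫ ω, inner ℝ (n t k ω) (x s l ω) ∂μ = 0
  orth_slope : ∀ t k l, ∫ ω, inner ℝ (n t k ω) (p (x t l ω)) ∂μ = 0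
  orth_noise : ∀ t k l, k ≠ l → ∫ ω, inner ℝ (n t k ω) (n t l ω) ∂μ = 0
  start : ∀ k ω, x 0 k ω = w₀
  local_step : ∀ t k ω, ¬ τ ∣ t + 1 → x (t + 1) k ω = x t k ω - η • (p (x t k ω) + n t k ω)
  sync_step : ∀ t k ω, τ ∣ t + 1 →
    x (t + 1) k ω = (K : ℝ)⁻¹ • ∑ l, (x t l ω - η • (p (x t l ω) + n t l ω))

theorem integral_sq_norm_sub_smul {Ω E : Type*} [MeasurableSpace Ω] {μ : Measure Ω}
    [NormedAddCommGroup E] [InnerProductSpace ℝ E] {f g : Ω → E} (hf : MemLp f 2 μ)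
    (hg : MemLp g 2 μ) (h : ∫ ω, inner ℝ (g ω) (f ω) ∂μ = 0) (c : ℝ) :
    ∫ ω, ‖f ω - c • g ω‖ ^ 2 ∂μ = ∫ ω, ‖f ω‖ ^ 2 ∂μ + c ^ 2 * ∫ ω, ‖g ω‖ ^ 2 ∂μ := by
  have e : ∀ ω, ‖f ω - c • g ω‖ ^ 2
      = ‖f ω‖ ^ 2 + c ^ 2 * ‖g ω‖ ^ 2 - 2 * c * inner ℝ (g ω) (f ω) := by
    intro ω
    rw [norm_sub_sq_real, inner_smul_right, norm_smul, mul_pow, Real.norm_eq_abs, sq_abs,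
      real_inner_comm]
    ring
  have i1 : Integrable (fun ω => ‖f ω‖ ^ 2) μ := hf.integrable_norm_pow two_ne_zero
  have i2 : Integrable (fun ω => c ^ 2 * ‖g ω‖ ^ 2) μ :=
    (hg.integrable_norm_pow two_ne_zero).const_mul _
  have i3 : Integrable (fun ω => 2 * c * inner ℝ (g ω) (f ω)) μ :=
    (hg.integrable_inner_real hf).const_mul _
  have i12 : Integrable (fun ω => ‖f ω‖ ^ 2 + c ^ 2 * ‖g ω‖ ^ 2) μ := i1.add i2
  simp_rw [e]
  rw [integral_sub i12 i3, integral_add i1 i2, integral_const_mul, integral_const_mul, h]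
  ring

theorem QuadraticBounds.integrable_comp {Ω E : Type*} [MeasurableSpace Ω] {μ : Measure Ω}
    [IsProbabilityMeasure μ] [NormedAddCommGroup E] [InnerProductSpace ℝ E] [CompleteSpace E]
    {M : ℝ} {F : E → ℝ} {p : E → E} (h : QuadraticBounds M F p) {f : Ω → E}
    (hf : MemLp f 2 μ) : Integrable (fun ω => F (f ω)) μ := by
  have i1 : Integrable (fun ω => ‖f ω‖) μ := (hf.integrable one_le_two).norm
  have i2 : Integrable (fun ω => ‖f ω‖ ^ 2) μ := hf.integrable_norm_pow two_ne_zero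
  refine Integrable.mono' (((integrable_const |F 0|).add (i1.const_mul ‖p 0‖)).add
    (i2.const_mul (M / 2))) (h.continuous.comp_aestronglyMeasurable hf.1)
    (Filter.Eventually.of_forall fun ω => ?_)
  have h1 := h.abs_sub_le 0 (f ω)
  rw [sub_zero] at h1
  have h2 := abs_sub_abs_le_abs_sub (F (f ω)) (F 0)
  simp only [Pi.add_apply, Real.norm_eq_abs]
  linarith

namespace LocalDescent

variable {Ω E : Type*} [MeasurableSpace Ω] {μ : Measure Ω} [NormedAddCommGroup E]
  [InnerProductSpace ℝ E] {K τ : ℕ} {η σ : ℝ} {p : E → E} {w₀ : E} {x n : ℕ → Fin K → Ω → E}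

/-- The remainder `t % τ` counts the local steps since the last synchronisation. Each adds noise of
variance at most `2 * η ^ 2 * σ ^ 2` to the difference of two nodes, while the gradient part is
nonexpansive. -/
theorem integral_sq_norm_sub_le (H : LocalDescent μ τ η σ p w₀ x n) {M : ℝ} {F : E → ℝ}
    (hM : 0 < M) (h : QuadraticBounds M F p) (hη : 0 ≤ η) (hηM : η * M ≤ 2) (t : ℕ)
    (k l : Fin K) :
    ∫ ω, ‖x t k ω - x t l ω‖ ^ 2 ∂μ ≤ 2 * η ^ 2 * σ ^ 2 * (t % τ : ℕ) := by
  induction t with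
  | zero => simp [H.start]
  | succ t ih =>
    by_cases hτ : τ ∣ t + 1
    · simp only [H.sync_step t _ _ hτ, sub_self, norm_zero]
      simp only [ne_eq, OfNat.ofNat_ne_zero, not_false_eq_true, zero_pow, integral_zero]
      positivity
    · have hmod : (t + 1) % τ = t % τ + 1 := by
        -- For `τ = 0` nodes never synchronise, and `t % 0 = t` still counts the steps.
        rcases Nat.eq_zero_or_pos τ with rfl | hpos
        · simp
        · rcases Nat.lt_or_ge (t % τ + 1) τ with hlt | hge
          · rw [← Nat.mod_add_mod, Nat.mod_eq_of_lt hlt]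
          · have := Nat.mod_lt t hpos
            refine absurd (Nat.dvd_of_mod_eq_zero ?_) hτ
            rw [← Nat.mod_add_mod, show t % τ + 1 = τ by omega, Nat.mod_self]
      rcases eq_or_ne k l with rfl | hkl
      · simp; positivity
      set f : Ω → E := fun ω => (x t k ω - η • p (x t k ω)) - (x t l ω - η • p (x t l ω))
      set g : Ω → E := fun ω => n t k ω - n t l ω
      have hf : MemLp f 2 μ :=
        ((H.memLp_iterate t k).sub ((H.memLp_slope t k).const_smul η)).sub
          ((H.memLp_iterate t l).sub ((H.memLp_slope t l).const_smul η))
      have hg : MemLp g 2 μ := (H.memLp_noise t k).sub (H.memLp_noise t l)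
      have e : ∀ ω, x (t + 1) k ω - x (t + 1) l ω = f ω - η • g ω := by
        intro ω
        rw [H.local_step t k ω hτ, H.local_step t l ω hτ]
        simp only [f, g, smul_add, smul_sub]
        abel
      have horth : ∀ j, ∫ ω, inner ℝ (n t j ω) (f ω) ∂μ = 0 := by
        intro j
        have i1 := fun m => (H.memLp_noise t j).integrable_inner_real (H.memLp_iterate t m)
        have i2 := fun m => ((H.memLp_noise t j).integrable_inner_real
          (H.memLp_slope t m)).const_mul η
        have i3 : ∀ m, Integrable (fun ω => inner ℝ (n t j ω) (x t m ω)
            - η * inner ℝ (n t j ω) (p (x t m ω))) μ := fun m => (i1 m).sub (i2 m)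
        simp only [f, inner_sub_right, inner_smul_right]
        rw [integral_sub (i3 k) (i3 l), integral_sub (i1 k) (i2 k),
          integral_sub (i1 l) (i2 l), integral_const_mul, integral_const_mul,
          H.orth_iterate t j t k le_rfl, H.orth_iterate t j t l le_rfl, H.orth_slope,
          H.orth_slope]
        simp
      have hgf : ∫ ω, inner ℝ (g ω) (f ω) ∂μ = 0 := by
        simp only [g, inner_sub_left]
        rw [integral_sub ((H.memLp_noise t k).integrable_inner_real hf)
          ((H.memLp_noise t l).integrable_inner_real hf), horth, horth, sub_zero]
      have hgg : ∫ ω, ‖g ω‖ ^ 2 ∂μ ≤ 2 * σ ^ 2 := by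
        have e1 : ∫ ω, ‖g ω‖ ^ 2 ∂μ = ∫ ω, ‖n t k ω - (1 : ℝ) • n t l ω‖ ^ 2 ∂μ := by simp [g]
        rw [e1, integral_sq_norm_sub_smul (H.memLp_noise t k) (H.memLp_noise t l)
          (H.orth_noise t l k hkl.symm)]
        linarith [H.variance_le t k, H.variance_le t l]
      have hff : ∫ ω, ‖f ω‖ ^ 2 ∂μ ≤ ∫ ω, ‖x t k ω - x t l ω‖ ^ 2 ∂μ :=
        integral_mono (hf.integrable_norm_pow two_ne_zero)
          (((H.memLp_iterate t k).sub (H.memLp_iterate t l)).integrable_norm_pow two_ne_zero)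
          fun ω => h.norm_gradientStep_sub_le hM hη hηM _ _
      simp_rw [e]
      rw [integral_sq_norm_sub_smul hf hg hgf, hmod]
      push_cast
      nlinarith [mul_le_mul_of_nonneg_left hgg (sq_nonneg η)]

theorem average_succ (H : LocalDescent μ τ η σ p w₀ x n) (hK : 1 ≤ K) (t : ℕ) (ω : Ω) :
    (K : ℝ)⁻¹ • ∑ k, x (t + 1) k ω = (K : ℝ)⁻¹ • ∑ k, x t k ω
      - η • ((K : ℝ)⁻¹ • ∑ k, p (x t k ω) + (K : ℝ)⁻¹ • ∑ k, n t k ω) := by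
  have hK0 : (K : ℝ) ≠ 0 := by positivity
  have e : (K : ℝ)⁻¹ • ∑ k, x (t + 1) k ω
      = (K : ℝ)⁻¹ • ∑ l, (x t l ω - η • (p (x t l ω) + n t l ω)) := by
    by_cases hτ : τ ∣ t + 1
    · simp only [H.sync_step t _ ω hτ]
      rw [Finset.sum_const, Finset.card_univ, Fintype.card_fin, ← Nat.cast_smul_eq_nsmul ℝ,
        inv_smul_smul₀ hK0]
    · simp only [H.local_step t _ ω hτ]
  rw [e, Finset.sum_sub_distrib, ← Finset.smul_sum, Finset.sum_add_distrib, ← smul_add,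
    smul_sub, smul_comm]

theorem memLp_average {y : Fin K → Ω → E} (hy : ∀ k, MemLp (y k) 2 μ) :
    MemLp (fun ω => (K : ℝ)⁻¹ • ∑ k, y k ω) 2 μ :=
  (memLp_finsetSum _ fun k _ => hy k).const_smul (K : ℝ)⁻¹

/-- Only the `K` diagonal terms of the double sum survive against the factor `K⁻²`; this is the
linear speedup in the number of nodes. -/
theorem integral_sq_norm_average_noise_le (H : LocalDescent μ τ η σ p w₀ x n) (hK : 1 ≤ K)
    (t : ℕ) : ∫ ω, ‖(K : ℝ)⁻¹ • ∑ k, n t k ω‖ ^ 2 ∂μ ≤ σ ^ 2 / K := by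
  have hK0 : (0 : ℝ) < K := by exact_mod_cast hK
  have i : ∀ k l, Integrable (fun ω => inner ℝ (n t k ω) (n t l ω)) μ := fun k l =>
    (H.memLp_noise t k).integrable_inner_real (H.memLp_noise t l)
  have e : ∀ ω, ‖(K : ℝ)⁻¹ • ∑ k, n t k ω‖ ^ 2
      = (K : ℝ)⁻¹ ^ 2 * ∑ k, ∑ l, inner ℝ (n t k ω) (n t l ω) := by
    intro ω
    rw [norm_smul, mul_pow, Real.norm_eq_abs, sq_abs, ← real_inner_self_eq_norm_sq, sum_inner]
    simp_rw [inner_sum]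
  simp_rw [e]
  rw [integral_const_mul, integral_finsetSum _ fun k _ => integrable_finsetSum _ fun l _ => i k l]
  have h1 : ∀ k, ∫ ω, ∑ l, inner ℝ (n t k ω) (n t l ω) ∂μ ≤ σ ^ 2 := by
    intro k
    rw [integral_finsetSum _ fun l _ => i k l, Finset.sum_eq_single k
      (fun l _ hl => H.orth_noise t k l hl.symm) (by simp)]
    simp_rw [real_inner_self_eq_norm_sq]
    exact H.variance_le t k
  calc _ ≤ (K : ℝ)⁻¹ ^ 2 * ∑ _k : Fin K, σ ^ 2 :=
        mul_le_mul_of_nonneg_left (Finset.sum_le_sum fun k _ => h1 k) (by positivity)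
    _ = σ ^ 2 / K := by simp; field_simp

theorem integral_consensus_le (H : LocalDescent μ τ η σ p w₀ x n) {M : ℝ} {F : E → ℝ}
    (hM : 0 < M) (h : QuadraticBounds M F p) (hK : 1 ≤ K) (hτ : 1 ≤ τ) (hη : 0 ≤ η)
    (hηM : η * M ≤ 2) (t : ℕ) :
    ∫ ω, (K : ℝ)⁻¹ * ∑ k, ‖x t k ω - (K : ℝ)⁻¹ • ∑ l, x t l ω‖ ^ 2 ∂μ
      ≤ 2 * η ^ 2 * σ ^ 2 * τ := by
  have hK0 : (0 : ℝ) < K := by exact_mod_cast hK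
  have hx := H.memLp_iterate t
  have i1 : ∀ k, Integrable (fun ω => ‖x t k ω - (K : ℝ)⁻¹ • ∑ l, x t l ω‖ ^ 2) μ := fun k =>
    ((hx k).sub (memLp_average hx)).integrable_norm_pow two_ne_zero
  have i2 : ∀ k l, Integrable (fun ω => ‖x t k ω - x t l ω‖ ^ 2) μ := fun k l =>
    ((hx k).sub (hx l)).integrable_norm_pow two_ne_zero
  have h1 : ∀ k, ∫ ω, ‖x t k ω - (K : ℝ)⁻¹ • ∑ l, x t l ω‖ ^ 2 ∂μ
      ≤ 2 * η ^ 2 * σ ^ 2 * τ := by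
    intro k
    calc _ ≤ ∫ ω, (K : ℝ)⁻¹ * ∑ l, ‖x t k ω - x t l ω‖ ^ 2 ∂μ :=
          integral_mono (i1 k) ((integrable_finsetSum _ fun l _ => i2 k l).const_mul _)
            fun ω => sq_norm_sub_average_le hK _ _
      _ = (K : ℝ)⁻¹ * ∑ l, ∫ ω, ‖x t k ω - x t l ω‖ ^ 2 ∂μ := by
          rw [integral_const_mul, integral_finsetSum _ fun l _ => i2 k l]
      _ ≤ (K : ℝ)⁻¹ * ∑ _l : Fin K, 2 * η ^ 2 * σ ^ 2 * τ := by
          gcongr with l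
          refine (H.integral_sq_norm_sub_le hM h hη hηM t k l).trans ?_
          gcongr
          exact (Nat.mod_lt _ hτ).le
      _ = _ := by simp; field_simp
  rw [integral_const_mul, integral_finsetSum _ fun k _ => i1 k]
  calc _ ≤ (K : ℝ)⁻¹ * ∑ _k : Fin K, 2 * η ^ 2 * σ ^ 2 * τ := by
        gcongr with k; exact h1 k
    _ = _ := by simp; field_simp

/-- Expected progress of one step of the averaged iterate relative to a past point `z`. -/
theorem integral_step_le [CompleteSpace E] [IsProbabilityMeasure μ]
    (H : LocalDescent μ τ η σ p w₀ x n) {M : ℝ} {F : E → ℝ}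
    (hM : 0 < M) (h : QuadraticBounds M F p) (hK : 1 ≤ K) (hτ : 1 ≤ τ) (hη : 0 < η)
    (hηM : η * M ≤ 1 / 2) (t : ℕ) {z : Ω → E} (hz : MemLp z 2 μ)
    (hnz : ∀ k, ∫ ω, inner ℝ (n t k ω) (z ω) ∂μ = 0) :
    ∫ ω, F ((K : ℝ)⁻¹ • ∑ k, x (t + 1) k ω) ∂μ - ∫ ω, F (z ω) ∂μ
      ≤ (2 * η)⁻¹ * (∫ ω, ‖(K : ℝ)⁻¹ • ∑ k, x t k ω - z ω‖ ^ 2 ∂μ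
          - ∫ ω, ‖(K : ℝ)⁻¹ • ∑ k, x (t + 1) k ω - z ω‖ ^ 2 ∂μ)
        + (η * σ ^ 2 / K + M * τ * η ^ 2 * σ ^ 2) := by
  set a : ℕ → Ω → E := fun t ω => (K : ℝ)⁻¹ • ∑ k, x t k ω with ha
  set N : Ω → E := fun ω => (K : ℝ)⁻¹ • ∑ k, n t k ω with hN
  set V : Ω → ℝ := fun ω => (K : ℝ)⁻¹ * ∑ k, ‖x t k ω - a t ω‖ ^ 2 with hV
  have haL : ∀ t, MemLp (a t) 2 μ := fun t => memLp_average (H.memLp_iterate t)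
  have hNL : MemLp N 2 μ := memLp_average (H.memLp_noise t)
  have haz : MemLp (fun ω => a t ω - z ω) 2 μ := (haL t).sub hz
  have i1 : ∀ t, Integrable (fun ω => ‖a t ω - z ω‖ ^ 2) μ := fun t =>
    ((haL t).sub hz).integrable_norm_pow two_ne_zero
  have i2 : Integrable (fun ω => inner ℝ (N ω) (a t ω - z ω)) μ := hNL.integrable_inner_real haz
  have i3 : Integrable (fun ω => ‖N ω‖ ^ 2) μ := hNL.integrable_norm_pow two_ne_zero
  have i4 : Integrable V μ := (integrable_finsetSum _ fun k _ =>
    ((H.memLp_iterate t k).sub (haL t)).integrable_norm_pow two_ne_zero).const_mul _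
  have j1 : Integrable (fun ω => (2 * η)⁻¹ * (‖a t ω - z ω‖ ^ 2 - ‖a (t + 1) ω - z ω‖ ^ 2)) μ :=
    ((i1 t).sub (i1 (t + 1))).const_mul _
  have j2 : Integrable (fun ω => (2 * η)⁻¹ * (‖a t ω - z ω‖ ^ 2 - ‖a (t + 1) ω - z ω‖ ^ 2)
      - inner ℝ (N ω) (a t ω - z ω)) μ := j1.sub i2
  have j3 : Integrable (fun ω => (2 * η)⁻¹ * (‖a t ω - z ω‖ ^ 2 - ‖a (t + 1) ω - z ω‖ ^ 2)
      - inner ℝ (N ω) (a t ω - z ω) + η * ‖N ω‖ ^ 2) μ := j2.add (i3.const_mul _)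
  have horth : ∫ ω, inner ℝ (N ω) (a t ω - z ω) ∂μ = 0 := by
    have ik : ∀ k, Integrable (fun ω => inner ℝ (n t k ω) (a t ω - z ω)) μ := fun k =>
      (H.memLp_noise t k).integrable_inner_real haz
    have hk : ∀ k, ∫ ω, inner ℝ (n t k ω) (a t ω - z ω) ∂μ = 0 := by
      intro k
      have il := fun l => (H.memLp_noise t k).integrable_inner_real (H.memLp_iterate t l)
      have ia : ∫ ω, inner ℝ (n t k ω) (a t ω) ∂μ = 0 := by
        simp only [ha, inner_smul_right, inner_sum]
        rw [integral_const_mul, integral_finsetSum _ fun l _ => il l]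
        simp [H.orth_iterate t k t _ le_rfl]
      simp only [inner_sub_right]
      rw [integral_sub ((H.memLp_noise t k).integrable_inner_real (haL t))
        ((H.memLp_noise t k).integrable_inner_real hz), ia, hnz, sub_zero]
    simp only [hN, real_inner_smul_left, sum_inner]
    rw [integral_const_mul, integral_finsetSum _ fun k _ => ik k]
    simp [hk]
  have hmono := integral_mono ((h.integrable_comp (haL (t + 1))).sub (h.integrable_comp hz))
    (j3.add (i4.const_mul (M / 2))) fun ω =>
      h.averagedStep_le hK hη hηM (fun k => x t k ω) (fun k => n t k ω) (a t ω) (a (t + 1) ω)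
        (z ω) rfl (H.average_succ hK t ω)
  simp only [Pi.add_apply, Pi.sub_apply] at hmono
  rw [integral_sub (h.integrable_comp (haL (t + 1))) (h.integrable_comp hz),
    integral_add j3 (i4.const_mul _), integral_add j2 (i3.const_mul _), integral_sub j1 i2,
    integral_const_mul, integral_const_mul, integral_const_mul, integral_sub (i1 t) (i1 (t + 1)),
    horth, sub_zero] at hmono
  have hN2 := mul_le_mul_of_nonneg_left (H.integral_sq_norm_average_noise_le hK t) hη.le
  have hV2 := mul_le_mul_of_nonneg_left
    (H.integral_consensus_le hM h hK hτ hη.le (by linarith) t) (by positivity : 0 ≤ M / 2)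
  have e1 : η * (σ ^ 2 / K) = η * σ ^ 2 / K := by ring
  have e2 : M / 2 * (2 * η ^ 2 * σ ^ 2 * τ) = M * τ * η ^ 2 * σ ^ 2 := by ring
  rw [e1] at hN2
  rw [e2] at hV2
  linarith

/-- The comparison point is frozen at time `s` and stays orthogonal to all later noise, so the
squared distances telescope. -/
theorem sum_integral_le [CompleteSpace E] [IsProbabilityMeasure μ]
    (H : LocalDescent μ τ η σ p w₀ x n) {M : ℝ} {F : E → ℝ}
    (hM : 0 < M) (h : QuadraticBounds M F p) (hK : 1 ≤ K) (hτ : 1 ≤ τ) (hη : 0 < η)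
    (hηM : η * M ≤ 1 / 2) (s : ℕ) {z : Ω → E} (hz : MemLp z 2 μ)
    (hnz : ∀ t k, s ≤ t → ∫ ω, inner ℝ (n t k ω) (z ω) ∂μ = 0) (m : ℕ) :
    ∑ j ∈ Finset.range m, ∫ ω, F ((K : ℝ)⁻¹ • ∑ k, x (s + j + 1) k ω) ∂μ
        + (2 * η)⁻¹ * ∫ ω, ‖(K : ℝ)⁻¹ • ∑ k, x (s + m) k ω - z ω‖ ^ 2 ∂μ
      ≤ (2 * η)⁻¹ * ∫ ω, ‖(K : ℝ)⁻¹ • ∑ k, x s k ω - z ω‖ ^ 2 ∂μ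
        + m * (∫ ω, F (z ω) ∂μ + (η * σ ^ 2 / K + M * τ * η ^ 2 * σ ^ 2)) := by
  induction m with
  | zero => simp
  | succ m ih =>
    have := H.integral_step_le hM h hK hτ hη hηM (s + m) hz fun k => hnz _ k (by omega)
    rw [Finset.sum_range_succ, ← add_assoc s m 1]
    push_cast
    linarith

/-- Last iterate bound for local gradient descent with orthogonal noise. -/
theorem integral_last_le [CompleteSpace E] [IsProbabilityMeasure μ]
    (H : LocalDescent μ τ η σ p w₀ x n) {M : ℝ} {F : E → ℝ}
    (hM : 0 < M) (h : QuadraticBounds M F p) (hK : 1 ≤ K) (hτ : 1 ≤ τ) (hη : 0 < η)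
    (hηM : η * M ≤ 1 / 2) {T : ℕ} (hT : 1 ≤ T) (w : E) :
    ∫ ω, F ((K : ℝ)⁻¹ • ∑ k, x T k ω) ∂μ - F w ≤ ‖w₀ - w‖ ^ 2 / (2 * η) / T
      + (η * σ ^ 2 / K + M * τ * η ^ 2 * σ ^ 2) * (1 + Real.log T) := by
  have hK0 : (K : ℝ) ≠ 0 := by positivity
  set e := η * σ ^ 2 / K + M * τ * η ^ 2 * σ ^ 2 with he
  have he0 : 0 ≤ e := by positivity
  set a : ℕ → ℝ := fun t => ∫ ω, F ((K : ℝ)⁻¹ • ∑ k, x t k ω) ∂μ with ha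
  have haL : ∀ t, MemLp (fun ω => (K : ℝ)⁻¹ • ∑ k, x t k ω) 2 μ := fun t =>
    memLp_average (H.memLp_iterate t)
  have hrefl : ∀ m, m ≤ T → ∑ i ∈ Finset.range m, (a (T - i) - F w)
      = ∑ j ∈ Finset.range m, a (T - m + j + 1) - m * F w := by
    intro m hm
    rw [Finset.sum_sub_distrib, Finset.sum_const, Finset.card_range, nsmul_eq_mul,
      ← Finset.sum_range_reflect]
    congr 1
    refine Finset.sum_congr rfl fun j hj => ?_
    rw [Finset.mem_range] at hj
    congr 1
    omega
  have hpast : ∀ s t k, s ≤ t →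
      ∫ ω, inner ℝ (n t k ω) ((K : ℝ)⁻¹ • ∑ l, x s l ω) ∂μ = 0 := by
    intro s t k hst
    simp only [inner_smul_right, inner_sum]
    rw [integral_const_mul, integral_finsetSum _ fun l _ =>
      (H.memLp_noise t k).integrable_inner_real (H.memLp_iterate s l)]
    simp [H.orth_iterate t k s _ hst]
  -- Gaps are listed backwards from time `T`. The suffix hypotheses use the mean iterate at time `T
  -- - m` as comparison point, the bound on the full sum uses `w`.
  have key := last_le_average_add_log (c := fun i => a (T - i) - F w) (e := e)
    (B := ‖w₀ - w‖ ^ 2 / (2 * η)) he0 hT ?_ ?_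
  · simpa using key
  · intro m hm
    have h1 := H.sum_integral_le hM h hK hτ hη hηM (T - m) (haL (T - m))
      (fun t k ht => hpast _ t k ht) m
    have h2 : 0 ≤ (2 * η)⁻¹ * ∫ ω, ‖(K : ℝ)⁻¹ • ∑ k, x (T - m + m) k ω
        - (K : ℝ)⁻¹ • ∑ k, x (T - m) k ω‖ ^ 2 ∂μ :=
      mul_nonneg (by positivity) (integral_nonneg fun ω => sq_nonneg _)
    simp only [sub_self, norm_zero, ne_eq, OfNat.ofNat_ne_zero, not_false_eq_true, zero_pow,
      integral_zero, mul_zero, zero_add] at h1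
    rw [hrefl m hm.le]
    have h3 : ∑ j ∈ Finset.range m, a (T - m + j + 1) ≤ m * (a (T - m) + e) :=
      (le_add_of_nonneg_right h2).trans h1
    linarith
  · have h1 := H.sum_integral_le hM h hK hτ hη hηM 0 (z := fun _ => w) (memLp_const w)
      (fun t k _ => H.orth_const t k w) T
    have h2 : 0 ≤ (2 * η)⁻¹ * ∫ ω, ‖(K : ℝ)⁻¹ • ∑ k, x (0 + T) k ω - w‖ ^ 2 ∂μ :=
      mul_nonneg (by positivity) (integral_nonneg fun ω => sq_nonneg _)
    have h0 : ∀ ω, (K : ℝ)⁻¹ • ∑ k, x 0 k ω = w₀ := by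
      intro ω
      simp only [H.start]
      rw [Finset.sum_const, Finset.card_univ, Fintype.card_fin, ← Nat.cast_smul_eq_nsmul ℝ,
        inv_smul_smul₀ hK0]
    simp only [h0, integral_const, probReal_univ, one_smul] at h1
    rw [hrefl T le_rfl, Nat.sub_self]
    have h3 := (le_add_of_nonneg_right h2).trans h1
    have h4 : (2 * η)⁻¹ * ‖w₀ - w‖ ^ 2 = ‖w₀ - w‖ ^ 2 / (2 * η) := by ring
    rw [h4] at h3
    have h5 : ∑ j ∈ Finset.range T, a (0 + j + 1) ≤ ‖w₀ - w‖ ^ 2 / (2 * η) + T * (F w + e) := h3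
    linarith

end LocalDescent

/-! ### Local SGD as a local descent, and the conclusion -/

theorem QuadraticBounds.memLp_slope {Ω E : Type*} [MeasurableSpace Ω] {μ : Measure Ω}
    [IsProbabilityMeasure μ] [NormedAddCommGroup E] [InnerProductSpace ℝ E] [CompleteSpace E]
    {M : ℝ} {F : E → ℝ} {p : E → E} (hM : 0 < M) (h : QuadraticBounds M F p) {f : Ω → E}
    (hf : MemLp f 2 μ) : MemLp (fun ω => p (f ω)) 2 μ := by
  refine MemLp.mono' ((memLp_const ‖p 0‖).add (hf.norm.const_mul M))
    ((h.continuous_slope hM).comp_aestronglyMeasurable hf.1)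
    (Filter.Eventually.of_forall fun ω => ?_)
  have h1 := h.norm_sub_le hM (f ω) 0
  rw [sub_zero] at h1
  have h2 := norm_sub_norm_le (p (f ω)) (p 0)
  simp only [Pi.add_apply]
  linarith

/-- Local SGD with independent samples is a local descent with orthogonal noise. -/
theorem localDescent_localSGD {d K : ℕ} {Ω Ξ : Type*} [MeasurableSpace Ω] [MeasurableSpace Ξ]
    {μ : Measure Ω} [IsProbabilityMeasure μ] {M σ : ℝ} {F : EuclideanSpace ℝ (Fin d) → ℝ}
    (hM : 0 < M) (h : QuadraticBounds M F (gradient F)) {ν : Fin K → Measure Ξ}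
    {g : Fin K → EuclideanSpace ℝ (Fin d) → Ξ → EuclideanSpace ℝ (Fin d)}
    (hg : ∀ k, StochasticGradient (ν k) σ F (g k)) {ξ : Fin K → ℕ → Ω → Ξ}
    (hξ : ∀ k t, Measurable (ξ k t)) (hν : ∀ k t, μ.map (ξ k t) = ν k)
    (hind : iIndepFun (fun i : Fin K × ℕ => ξ i.1 i.2) μ) (τ : ℕ) (η : ℝ)
    (w₀ : EuclideanSpace ℝ (Fin d)) :
    LocalDescent μ τ η σ (gradient F) w₀
      (fun t k ω => localSGD τ η g w₀ (fun k t => ξ k t ω) t k)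
      (fun t k ω => g k (localSGD τ η g w₀ (fun k t => ξ k t ω) t k) (ξ k t ω)
        - gradient F (localSGD τ η g w₀ (fun k t => ξ k t ω) t k)) := by
  set x : ℕ → Fin K → Ω → EuclideanSpace ℝ (Fin d) :=
    fun t k ω => localSGD τ η g w₀ (fun k t => ξ k t ω) t k with hx
  set n : ℕ → Fin K → Ω → EuclideanSpace ℝ (Fin d) :=
    fun t k ω => g k (x t k ω) (ξ k t ω) - gradient F (x t k ω) with hn
  set ζ : Fin K × ℕ → Ω → Ξ := fun i => ξ i.1 i.2 with hζ
  have hζm : ∀ i, Measurable (ζ i) := fun i => hξ i.1 i.2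
  have hp : Measurable (gradient F) := (h.continuous_slope hM).measurable
  have hgm : ∀ k, Measurable (Function.uncurry (g k)) := fun k => (hg k).measurable
  have hxS : ∀ (S : Set (Fin K × ℕ)) (t s : ℕ) (l : Fin K), (∀ i : Fin K × ℕ, i.2 < t → i ∈ S) →
      s ≤ t → Measurable[sampleAlgebra ζ S] (x s l) := fun S t s l hS hst =>
    @measurable_localSGD d K Ω Ξ (sampleAlgebra ζ S) _ g hgm τ η w₀ ξ t
      (fun k r hr => measurable_sampleAlgebra ζ (hS (k, r) hr)) s hst l
  have hxm : ∀ t k, Measurable (x t k) := fun t k =>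
    measurable_localSGD hgm τ η w₀ (fun k r _ => hξ k r) t le_rfl k
  have hxind : ∀ t k, IndepFun (x t k) (ξ k t) μ := fun t k =>
    indepFun_of_measurable_sampleAlgebra (S := {i | i.2 < t}) (i := (k, t)) hζm hind (by simp)
      (hxS _ t t k (fun _ hi => hi) le_rfl)
  have hn2 : ∀ t k, MemLp (n t k) 2 μ := fun t k =>
    (hg k).memLp_noise hp (hxm t k) (hξ k t) (hν k t) (hxind t k)
  have hx2 : ∀ t k, MemLp (x t k) 2 μ := by
    intro t
    induction t with
    | zero => exact fun k => memLp_const w₀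
    | succ t ih =>
      have hstep : ∀ k, MemLp (fun ω => x t k ω - η • g k (x t k ω) (ξ k t ω)) 2 μ := by
        intro k
        have := (ih k).sub (((hn2 t k).add (h.memLp_slope hM (ih k))).const_smul η)
        convert! this using 2 with ω
        simp only [hn, Pi.sub_apply, Pi.add_apply, Pi.smul_apply, sub_add_cancel]
      intro k
      by_cases hτ : τ ∣ t + 1
      · simp only [hx, localSGD, if_pos hτ]
        exact LocalDescent.memLp_average hstep
      · simp only [hx, localSGD, if_neg hτ]
        exact hstep k
  have horth : ∀ (S : Set (Fin K × ℕ)) (t : ℕ) (k : Fin K)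
      (Z : Ω → EuclideanSpace ℝ (Fin d)), (∀ i : Fin K × ℕ, i.2 < t → i ∈ S) → (k, t) ∉ S →
      Measurable[sampleAlgebra ζ S] Z → MemLp Z 2 μ → ∫ ω, inner ℝ (n t k ω) (Z ω) ∂μ = 0 :=
    fun S t k Z hS hkt hZ hZ2 =>
      (hg k).integral_inner_noise_eq_zero hp (hxm t k) (hξ k t) (hν k t)
        (hZ.mono (sampleAlgebra_le hζm S) le_rfl) hZ2
        (indepFun_of_measurable_sampleAlgebra (S := S) (i := (k, t)) hζm hind hkt
          ((hxS S t t k hS le_rfl).prodMk hZ))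
  have hpast : ∀ (t : ℕ) (k : Fin K), (k, t) ∉ {i : Fin K × ℕ | i.2 < t} := by simp
  exact
    { memLp_iterate := hx2
      memLp_slope := fun t k => h.memLp_slope hM (hx2 t k)
      memLp_noise := hn2
      variance_le := fun t k =>
        ((hg k).integrable_sq_noise hp (hxm t k) (hξ k t) (hν k t) (hxind t k)).2
      orth_const := fun t k z => horth _ t k (fun _ => z) (fun _ hi => hi) (hpast t k)
        measurable_const (memLp_const z)
      orth_iterate := fun t k s l hst => horth _ t k (x s l) (fun _ hi => hi) (hpast t k)
        (hxS _ t s l (fun _ hi => hi) hst) (hx2 s l)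
      orth_slope := fun t k l => horth _ t k (fun ω => gradient F (x t l ω)) (fun _ hi => hi)
        (hpast t k) (hp.comp (hxS _ t t l (fun _ hi => hi) le_rfl)) (h.memLp_slope hM (hx2 t l))
      orth_noise := fun t k l hkl => by
        -- The noise of node `l` at the same step is not a function of the past, so its own sample
        -- is adjoined; the sample `(k, t)` is still excluded.
        have hS : ∀ i : Fin K × ℕ, i.2 < t → i ∈ {i : Fin K × ℕ | i.2 < t ∨ i = (l, t)} :=
          fun _ hi => Or.inl hi
        have hxl := hxS _ t t l hS le_rfl
        refine horth _ t k (n t l) hS (by simp [hkl]) ?_ (hn2 t l)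
        exact ((hgm l).comp (hxl.prodMk (measurable_sampleAlgebra ζ (i := (l, t))
          (Or.inr rfl)))).sub (hp.comp hxl)
      start := fun k ω => rfl
      local_step := fun t k ω hτ => by
        simp only [hx, hn, localSGD, if_neg hτ, add_sub_cancel]
      sync_step := fun t k ω hτ => by
        simp only [hx, hn, localSGD, if_pos hτ, add_sub_cancel] }

theorem mainTheorem5 (σ : ℝ) (hσ : 0 ≤ σ) :
    ∃ C : ℝ, 0 < C ∧
      ∀ (β rmax D : ℝ) (K τ R : ℕ), 0 < β → 0 < D → 1 ≤ K → 1 ≤ τ → 1 ≤ R →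
      ∃ η : ℝ, 0 < η ∧
      ∀ (d : ℕ) (X Y V Θ Ξ Ω : Type*) [MeasurableSpace X] [MeasurableSpace Y] [Fintype Y]
        [MeasurableSingletonClass Y] [MeasurableSpace Ξ] [MeasurableSpace Ω]
        (S : MultiNode d K X Y V Θ), S.Regular →
      -- the loss is convex and smooth in the model parameters
      (∀ x y, ConvexSmooth β (fun w => S.loss (S.model w x) y)) →
      -- `rmax` is the maximum over labels of the supremum over predictors of the ratios
      IsLUB S.ratioValues rmax →
      -- phases 1 and 2: `ρ k` is the ratio that node `k` estimates with its predictor `f_{θ k}`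
      ∀ (θ : Fin K → Θ) (ρ : Fin K → Y → ℝ), (∀ k, S.IsRatioEstimate k (θ k) (ρ k)) →
      -- minimizer, and initial distance
      ∀ (wstar w₀ : EuclideanSpace ℝ (Fin d)), (∀ w, S.risk ρ wstar ≤ S.risk ρ w) →
      ‖w₀ - wstar‖ = D →
      -- stochastic gradients, and the independent samples at which they are evaluated
      ∀ (ν : Fin K → Measure Ξ)
        (g : Fin K → EuclideanSpace ℝ (Fin d) → Ξ → EuclideanSpace ℝ (Fin d)),
      (∀ k, StochasticGradient (ν k) σ (S.risk ρ) (g k)) →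
      ∀ (μ : Measure Ω) [IsProbabilityMeasure μ] (ξ : Fin K → ℕ → Ω → Ξ),
      (∀ k t, Measurable (ξ k t)) → (∀ k t, μ.map (ξ k t) = ν k) →
      iIndepFun (fun i : Fin K × ℕ => ξ i.1 i.2) μ →
      Integrable (fun ω =>
        S.risk ρ (globalIterate τ η g w₀ (fun k t => ξ k t ω) (τ * R)) - S.risk ρ wstar) μ ∧
      ∫ ω, (S.risk ρ (globalIterate τ η g w₀ (fun k t => ξ k t ω) (τ * R))
          - S.risk ρ wstar) ∂μ
        ≤ C * (1 + Real.log ((τ : ℝ) * R)) *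
          (rmax * β * D ^ 2 / (τ * R)
            + (rmax * β * D ^ 4) ^ ((1 : ℝ) / 3) / (Real.sqrt τ * R) ^ ((2 : ℝ) / 3)
            + D / Real.sqrt (K * τ * R)) := by
  refine ⟨2 + 2 * σ ^ 2, by positivity, ?_⟩
  intro β rmax D K τ R hβ hD hK hτ hR
  have hK0 : (0 : ℝ) < K := by exact_mod_cast hK
  have hτ1 : (1 : ℝ) ≤ τ := by exact_mod_cast hτ
  have hR1 : (1 : ℝ) ≤ R := by exact_mod_cast hR
  by_cases hr0 : 0 < rmax
  swap
  -- The step size is chosen before the problem is given, so `rmax ≤ 0` needs some value; no regular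
  -- problem with ratio estimates realises it.
  · refine ⟨1, one_pos, ?_⟩
    intro d X Y V Θ Ξ Ω _ _ _ _ _ _ S hS _ hlub θ ρ hρ
    exact absurd (MultiNode.pos_of_aggregate_le hS hK (fun k => (hρ k).1)
      fun k y => hlub.1 ⟨θ, ρ, hρ, k, y, rfl⟩) hr0
  have hL : 0 < rmax * β := mul_pos hr0 hβ
  refine ⟨balancedStep (rmax * β) D K τ (τ * R),
    balancedStep_pos hL hD hK0 (by linarith) (by nlinarith), ?_⟩
  intro d X Y V Θ Ξ Ω _ _ _ _ _ _ S hS hφ hlub θ ρ hρ wstar w₀ _ hdist ν g hg μ _ ξ hξ hν hind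
  set η := balancedStep (rmax * β) D K τ (τ * R) with hη
  have hη0 : 0 < η := balancedStep_pos hL hD hK0 (by linarith) (by nlinarith)
  have hM : 0 < 2 * β * rmax := by positivity
  have hηM : η * (2 * β * rmax) ≤ 1 / 2 := by
    -- With `M = 2 * (rmax * β)`, the requirement `η * M ≤ 1 / 2` is exactly the first entry of the
    -- minimum in `balancedStep`.
    have h1 : η ≤ 1 / (4 * (rmax * β)) := min_le_left _ _
    rw [le_div_iff₀ (by positivity)] at h1
    linarith
  obtain ⟨p, hp⟩ := MultiNode.exists_quadraticBounds_risk hS hK hβ.le hφ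
    (fun k => (hρ k).1) fun k y => hlub.1 ⟨θ, ρ, hρ, k, y, rfl⟩
  rw [← hp.gradient_eq] at hp
  have H := localDescent_localSGD hM hp hg hξ hν hind τ η w₀
  have hint : Integrable
      (fun ω => S.risk ρ (globalIterate τ η g w₀ (fun k t => ξ k t ω) (τ * R))) μ :=
    hp.integrable_comp (LocalDescent.memLp_average (H.memLp_iterate (τ * R)))
  refine ⟨hint.sub (integrable_const _), ?_⟩
  have hlast := H.integral_last_le hM hp hK hτ hη0 hηM
    (Nat.one_le_iff_ne_zero.2 (by positivity) : 1 ≤ τ * R) wstar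
  have hstep := balancedStep_error_le (σ := σ) hL hD hK0 hτ1 hR1 hη
  rw [integral_sub hint (integrable_const _), integral_const, probReal_univ, one_smul]
  rw [hdist] at hlast
  push_cast at hlast
  have e : 2 * β * rmax * τ * η ^ 2 * σ ^ 2 = 2 * (rmax * β) * τ * η ^ 2 * σ ^ 2 := by ring
  rw [e] at hlast
  exact hlast.trans hstep
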